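/- Let $k$ be an algebraically closed field and let $A=kQ/I$ be a triangular algebra, i.e. $Q$ is a finite quiver without oriented cycles, with vertex set $Q_0$ and arrow set $Q_1$, and $I$ is an admissible ideal of the path algebra $kQ$. For $i,j\in Q_0$ let $I(i,j)$ be the set of elements of $I$ that are linear combinations of paths from $i$ to $j$, let $R$ be a minimal set of generators of $I$ contained in $\bigcup_{i,j\in Q_0} I(i,j)$, and let $r(i,j)=|R\cap I(i,j)|$. Let $$q_A(x)=\sum_{i\in Q_0}x(i)^2-\sum_{(i\to j)\in Q_1}x(i)x(j)+\sum_{i,j\in Q_0}r(i,j)x(i)x(j)\qquad(x\in\mathbb{Z}^{Q_0})$$ be the Tits form of $A$, and put $q_{ij}=q_A(e_i+e_j)-q_A(e_i)-q_A(e_j)$ for $i\neq j$, where $(e_i)$ is the canonical basis of $\mathbb{Z}^{Q_0}$. A root of $q_A$ is a vector $v\in\mathbb{Z}^{Q_0}$ with non-negative coordinates and $q_A(v)=1$; it is omnipresent if $v(i)>0$ for every $i\in Q_0$, and maximal if $w=v$ for every root $w\ge v$ (coordinatewise). Suppose that $q_A$ is slender, i.e. $q_{ij}\ge -1$ for all $i\neq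 j$, and that $q_A$ has a maximal omnipresent root $v$. Then $q_A$ is weakly non-negative, i.e. $q_A(x)\ge 0$ for every $x\in\mathbb{Z}^{Q_0}$ with non-negative coordinates. Moreover, $v(i)\le 12$ for every $i\in Q_0$. -/

import Mathlib

/-! ### The path algebra of a finite quiver -/

/-- All oriented paths of a quiver (with their end points), including the trivial ones. -/
abbrev AllPaths (V : Type*) [Quiver V] := Σ i j : V, Quiver.Path i j

/-- The underlying space of the path algebra `kQ`: the `k`-vector space with basis the
oriented paths of `Q`. -/
def PathAlgebra (k V : Type*) [Field k] [Quiver V] := AllPaths V →₀ k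

namespace PathAlgebra

variable {k V : Type*} [Field k] [Quiver V]

noncomputable instance : AddCommGroup (PathAlgebra k V) :=
  inferInstanceAs (AddCommGroup (AllPaths V →₀ k))

noncomputable instance : Module k (PathAlgebra k V) :=
  inferInstanceAs (Module k (AllPaths V →₀ k))

/-- The basis of `kQ` consisting of the oriented paths. -/
noncomputable def pathBasis (k V : Type*) [Field k] [Quiver V] :
    Module.Basis (AllPaths V) k (PathAlgebra k V) :=
  Module.Basis.ofRepr (LinearEquiv.refl k (AllPaths V →₀ k))

/-- The basis vector of `kQ` given by a path. -/
noncomputable def ofPath (p : AllPaths V) : PathAlgebra k V := pathBasis k V p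

open Classical in
/-- Product of two basis vectors: concatenation ("first `p`, then `q`") if the paths are
composable, and zero otherwise. -/
noncomputable def pathMul (p q : AllPaths V) : PathAlgebra k V :=
  if h : p.2.1 = q.1 then
    ofPath ⟨p.1, q.2.1, p.2.2.comp (q.2.2.cast h.symm rfl)⟩
  else 0

/-- The bilinear extension of `pathMul`. -/
noncomputable def mulMap : PathAlgebra k V →ₗ[k] PathAlgebra k V →ₗ[k] PathAlgebra k V :=
  (pathBasis k V).constr k fun p => (pathBasis k V).constr k fun q => pathMul p q

noncomputable instance : Mul (PathAlgebra k V) := ⟨fun x y => mulMap x y⟩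

/-- The unit is the sum of the trivial paths. -/
noncomputable instance [Fintype V] : One (PathAlgebra k V) :=
  ⟨∑ i : V, ofPath ⟨i, i, Quiver.Path.nil⟩⟩

theorem mul_def (x y : PathAlgebra k V) : x * y = mulMap x y := rfl

theorem one_def [Fintype V] :
    (1 : PathAlgebra k V) = ∑ i : V, ofPath ⟨i, i, Quiver.Path.nil⟩ := rfl

theorem induction {P : PathAlgebra k V → Prop} (x : PathAlgebra k V)
    (h0 : P 0) (hadd : ∀ x y, P x → P y → P (x + y))
    (hs : ∀ (c : k) (p : AllPaths V), P (c • ofPath p)) : P x := by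
  rw [← (pathBasis k V).linearCombination_repr x, Finsupp.linearCombination_apply]
  exact Finset.sum_induction _ P hadd h0 fun p _ => hs _ p

theorem ofPath_mul_ofPath (p q : AllPaths V) :
    (ofPath p : PathAlgebra k V) * ofPath q = pathMul p q := by
  simp only [mul_def, mulMap, ofPath, Module.Basis.constr_basis]

theorem add_mul' (x y z : PathAlgebra k V) : (x + y) * z = x * z + y * z := by
  simp [mul_def]

theorem mul_add' (x y z : PathAlgebra k V) : x * (y + z) = x * y + x * z := by
  simp [mul_def]

theorem smul_mul' (c : k) (x y : PathAlgebra k V) : (c • x) * y = c • (x * y) := by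
  simp [mul_def]

theorem mul_smul' (c : k) (x y : PathAlgebra k V) : x * (c • y) = c • (x * y) := by
  simp [mul_def]

theorem zero_mul' (x : PathAlgebra k V) : 0 * x = 0 := by simp [mul_def]

theorem mul_zero' (x : PathAlgebra k V) : x * 0 = 0 := by simp [mul_def]

theorem ofPath_assoc (p q r : AllPaths V) :
    (ofPath p * ofPath q : PathAlgebra k V) * ofPath r = ofPath p * (ofPath q * ofPath r) := by
  obtain ⟨a, b, p⟩ := p
  obtain ⟨c, d, q⟩ := q
  obtain ⟨e, f, r⟩ := r
  rw [ofPath_mul_ofPath, ofPath_mul_ofPath]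
  by_cases h1 : b = c
  · subst h1
    by_cases h2 : d = e
    · subst h2
      simp [pathMul, ofPath_mul_ofPath]
    · simp [pathMul, ofPath_mul_ofPath, h2, mul_zero']
  · by_cases h2 : d = e
    · subst h2
      simp [pathMul, ofPath_mul_ofPath, h1, zero_mul']
    · simp [pathMul, h1, h2, zero_mul', mul_zero']

theorem mul_assoc' (x y z : PathAlgebra k V) : x * y * z = x * (y * z) := by
  refine induction (P := fun x => x * y * z = x * (y * z)) x (by simp [zero_mul'])
    (fun a b ha hb => by simp [add_mul', ha, hb]) fun c p => ?_
  refine induction (P := fun y => c • ofPath p * y * z = c • ofPath p * (y * z)) y (by simp [zero_mul', mul_zero'])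
    (fun a b ha hb => by simp [add_mul', mul_add', ha, hb]) fun d q => ?_
  refine induction (P := fun z => c • ofPath p * d • ofPath q * z =
    c • ofPath p * (d • ofPath q * z)) z (by simp [mul_zero']) (fun a b ha hb => by simp [mul_add', ha, hb])
    fun e r => ?_
  simp only [smul_mul', mul_smul', ofPath_assoc]

theorem sum_mul' {ι : Type*} (s : Finset ι) (f : ι → PathAlgebra k V) (x : PathAlgebra k V) :
    (∑ i ∈ s, f i) * x = ∑ i ∈ s, f i * x := by
  simp [mul_def]

theorem mul_sum' {ι : Type*} (s : Finset ι) (f : ι → PathAlgebra k V) (x : PathAlgebra k V) :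
    x * (∑ i ∈ s, f i) = ∑ i ∈ s, x * f i := by
  simp [mul_def]

theorem one_mul' [Fintype V] (x : PathAlgebra k V) : 1 * x = x := by
  refine induction (P := fun x => 1 * x = x) x (by simp [mul_zero']) (fun a b ha hb => by simp [mul_add', ha, hb])
    fun c p => ?_
  obtain ⟨a, b, p⟩ := p
  rw [mul_smul', one_def, sum_mul', Finset.sum_eq_single a]
  · simp [ofPath_mul_ofPath, pathMul]
  · intro i _ hi
    simp [ofPath_mul_ofPath, pathMul, hi]
  · simp

theorem mul_one' [Fintype V] (x : PathAlgebra k V) : x * 1 = x := by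
  refine induction (P := fun x => x * 1 = x) x (by simp [zero_mul']) (fun a b ha hb => by simp [add_mul', ha, hb])
    fun c p => ?_
  obtain ⟨a, b, p⟩ := p
  rw [smul_mul', one_def, mul_sum', Finset.sum_eq_single b]
  · simp [ofPath_mul_ofPath, pathMul]
  · intro i _ hi
    simp [ofPath_mul_ofPath, pathMul, Ne.symm hi]
  · simp

noncomputable instance [Fintype V] : Ring (PathAlgebra k V) :=
  { (inferInstance : AddCommGroup (PathAlgebra k V)),
    (inferInstance : Mul (PathAlgebra k V)),
    (inferInstance : One (PathAlgebra k V)) with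
    left_distrib := mul_add'
    right_distrib := add_mul'
    zero_mul := zero_mul'
    mul_zero := mul_zero'
    mul_assoc := mul_assoc'
    one_mul := one_mul'
    mul_one := mul_one' }

noncomputable instance [Fintype V] : Algebra k (PathAlgebra k V) :=
  Algebra.ofModule smul_mul' mul_smul'

/-- The linear combinations of paths of length at least `m`; this is the `m`-th power of the
ideal of `kQ` generated by the arrows. -/
noncomputable def arrowPower (k V : Type*) [Field k] [Quiver V] (m : ℕ) :
    Submodule k (PathAlgebra k V) :=
  Submodule.span k {x | ∃ p : AllPaths V, m ≤ p.2.2.length ∧ x = ofPath p}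

/-- The linear combinations of paths from `i` to `j`. -/
noncomputable def between (k : Type*) {V : Type*} [Field k] [Quiver V] (i j : V) :
    Submodule k (PathAlgebra k V) :=
  Submodule.span k {x | ∃ p : Quiver.Path i j, x = ofPath ⟨i, j, p⟩}

end PathAlgebra

/-! ### Bound quivers, triangular algebras and the Tits form -/

/-- A quiver without oriented cycles. -/
def Quiver.NoOrientedCycles (V : Type*) [Quiver V] : Prop :=
  ∀ (i : V) (p : Quiver.Path i i), p.length = 0

namespace BoundQuiver

variable {k V : Type*} [Field k] [Fintype V] [Quiver V]

/-- A two-sided ideal `I` of `kQ` is admissible if `J ^ m ⊆ I ⊆ J ^ 2` for some `m ≥ 2`, where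
`J` is the ideal generated by the arrows. -/
def IsAdmissible (I : TwoSidedIdeal (PathAlgebra k V)) : Prop :=
  (∃ m : ℕ, 2 ≤ m ∧ ∀ x ∈ PathAlgebra.arrowPower k V m, x ∈ I) ∧
    ∀ x ∈ I, x ∈ PathAlgebra.arrowPower k V 2

/-- `I(i, j)`: the elements of `I` that are linear combinations of paths from `i` to `j`. -/
def idealBetween (I : TwoSidedIdeal (PathAlgebra k V)) (i j : V) : Set (PathAlgebra k V) :=
  {x | x ∈ I ∧ x ∈ PathAlgebra.between k i j}

/-- `R` is a minimal set of generators of the two-sided ideal `I` contained in the union of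
the sets `I(i, j)`. -/
structure IsMinimalRelations (I : TwoSidedIdeal (PathAlgebra k V))
    (R : Set (PathAlgebra k V)) : Prop where
  subset : R ⊆ ⋃ (i : V) (j : V), idealBetween I i j
  span_eq : TwoSidedIdeal.span R = I
  minimal : ∀ S ⊆ R, TwoSidedIdeal.span S = I → S = R

/-- `r(i, j)`: the number of elements of `R ∩ I(i, j)`. -/
noncomputable def relationCount (I : TwoSidedIdeal (PathAlgebra k V))
    (R : Set (PathAlgebra k V)) (i j : V) : ℕ :=
  (R ∩ idealBetween I i j).ncard

/-- The Tits form of `A = kQ/I`, computed with a minimal set `R` of relations: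
`q_A(v) = ∑ v(i)² - ∑_{i → j} v(i) v(j) + ∑_{i, j} r(i, j) v(i) v(j)`. -/
noncomputable def titsForm [∀ i j : V, Fintype (i ⟶ j)]
    (I : TwoSidedIdeal (PathAlgebra k V)) (R : Set (PathAlgebra k V)) (v : V → ℤ) : ℤ :=
  ∑ i, v i ^ 2 - ∑ i, ∑ j, ∑ _a : i ⟶ j, v i * v j
    + ∑ i, ∑ j, (relationCount I R i j : ℤ) * v i * v j

end BoundQuiver

/-! ### Integral quadratic forms -/

namespace IntForm

variable {V : Type*}

/-- `q` is slender if its coefficients `q_ij = q(e_i, e_j) = q(e_i + e_j) - q(e_i) - q(e_j)`,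
`i ≠ j`, are all at least `-1`. -/
def IsSlender [DecidableEq V] (q : (V → ℤ) → ℤ) : Prop :=
  ∀ i j : V, i ≠ j → -1 ≤ QuadraticMap.polar q (Pi.single i 1) (Pi.single j 1)

/-- A root of `q`: a vector with non-negative coordinates and `q(v) = 1`. -/
def IsRoot (q : (V → ℤ) → ℤ) (v : V → ℤ) : Prop := 0 ≤ v ∧ q v = 1

/-- A root `v` of `q` is maximal if `w = v` for every root `w ≥ v`. -/
def IsMaximalRoot (q : (V → ℤ) → ℤ) (v : V → ℤ) : Prop :=
  IsRoot q v ∧ ∀ w, IsRoot q w → v ≤ w → w = v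

/-- A vector is omnipresent if all its coordinates are positive. -/
def IsOmnipresent (v : V → ℤ) : Prop := ∀ i, 0 < v i

/-- `q` is weakly non-negative if `q(v) ≥ 0` for all `v` with non-negative coordinates. -/
def IsWeaklyNonneg (q : (V → ℤ) → ℤ) : Prop := ∀ v : V → ℤ, 0 ≤ v → 0 ≤ q v

end IntForm

/-! Write `B` for the polar form. Since `Q` has no oriented cycles and `I` lies in the square of the
arrow ideal, no loop or relation runs from a vertex to itself, so `q` is an integral unit form. The
rest of the argument concerns such forms only.

Weak non-negativity (`IsMaximalRoot.isWeaklyNonneg`). Maximality of `v` makes `B v` non-negative on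
the positive cone, and positive on non-zero isotropic vectors there. Take `y` in the cone of least
coordinate sum with `q y < 0`. Minimality bounds each `B y e_i` on the support of `y` from above,
slenderness bounds it from below, and only `q y = -1` or `q y = -2` survive. In each case a vector
`v + t y` with `t > 0` is a root or the bounds clash.

The bound (`IsMaximalRoot.le_twelve`). Put `φ = B v`; then `φ v = 2`, and `q` is positive on the
non-zero vectors of the cone killed by `φ`. If `φ e_p > 0`, then `v p ≤ 2`. Otherwise subtract some
`e_a` with `φ e_a > 0`: what is left is a root with `φ = 1`, or a vector with `φ = 0` and `q ≤ 2`.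
So it suffices that roots have `p`-coordinate at most `6` when `φ = 0` (`root_le_six`) and at most
`12` when `φ = 1` (`root_le_twelve`).

For these, take a root `x` whose `p`-coordinate `m` is too large, extremal in the sense of
`IsExtremalStar`, and split `x - m e_p` into roots `w i` with non-negative mutual products. Each has
product `-1` with `e_p`, so they form a star around `e_p`. Those with `φ = 0` split into low ones
(`B x (w i) = -1`), nearly a clique and nearly orthogonal to the others, and flat ones (`B x (w i) =
0`), without independent triples. If `m` is large, the star contains three mutually orthogonal
cliques which, with `e_p`, carry the radical vector of an extended Dynkin diagram of type E6, E7 or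
E8. That vector is isotropic and killed by `φ`, contradicting positivity. -/

/-! ### Weighted graphs without three orthogonal cliques -/

namespace CliqueWeights

variable {ι : Type*} [DecidableEq ι]

/-- Pairwise weight one on `s`. -/
def IsUnitClique (Q : ι → ι → ℤ) (s : Finset ι) : Prop :=
  ∀ i ∈ s, ∀ j ∈ s, i ≠ j → Q i j = 1

/-- All weights between `s` and `t` vanish. -/
def Orthogonal (Q : ι → ι → ℤ) (s t : Finset ι) : Prop :=
  ∀ i ∈ s, ∀ j ∈ t, Q i j = 0

/-- Double counting. Let `z l` be the set of vertices orthogonal to `l` and `s l` the total excess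
of weights over `1`, so `s l + 2 ≤ |z l|`. Without the desired triple, distinct members of `z l`
other than `o` have weight at least `2`, so for orthogonal `l`, `k` each excess nearly bounds the
other zero set. Since `o` lies in at most one of `z l`, `z k`, the totals are off by one. -/
theorem exists_path_avoiding {Q : ι → ι → ℤ} {B : Finset ι} (symm : ∀ i j, Q i j = Q j i)
    (nonneg : ∀ i ∈ B, ∀ j ∈ B, i ≠ j → 0 ≤ Q i j) (hB : B.Nonempty)
    (sum_le : ∀ l ∈ B, ∑ j ∈ B.erase l, (Q l j - 1) ≤ -2)
    (indep : ∀ i ∈ B, ∀ j ∈ B, ∀ k ∈ B, i ≠ j → i ≠ k → j ≠ k →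
      Q i j = 0 → Q i k = 0 → Q j k ≠ 0) (o : ι) :
    ∃ l ∈ B, ∃ k ∈ B, ∃ k' ∈ B, l ≠ o ∧ k ≠ o ∧ k' ≠ o ∧ l ≠ k ∧ l ≠ k' ∧ k ≠ k' ∧
      Q l k = 0 ∧ Q l k' = 0 ∧ Q k k' = 1 := by
  by_contra hcon
  push Not at hcon
  let z : ι → Finset ι := fun l => (B.erase l).filter fun j => Q l j = 0
  let s : ι → ℤ := fun l => ∑ j ∈ B.erase l, max (Q l j - 1) 0
  have hsz : ∀ l ∈ B, s l + 2 ≤ (z l).card := by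
    intro l hl
    have h1 : ∑ j ∈ B.erase l, (Q l j - 1) = s l - (z l).card := by
      simp only [s, z, Finset.card_filter]
      push_cast
      rw [← Finset.sum_sub_distrib]
      refine Finset.sum_congr rfl fun j hj => ?_
      have := nonneg l hl j (Finset.mem_of_mem_erase hj) (Finset.ne_of_mem_erase hj).symm
      split_ifs with h
      · simp [h]
      · rw [max_eq_left (by omega)]; ring
    have := sum_le l hl
    omega
  have key : ∀ l ∈ B, l ≠ o → ∀ k ∈ (z l).erase o, (((z l).erase o).card : ℤ) ≤ s k + 1 := by
    intro l hl hlo k hk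
    simp only [z, Finset.mem_erase, Finset.mem_filter] at hk
    obtain ⟨hko, ⟨hkl, hkB⟩, hlk⟩ := hk
    have h1 : ((((z l).erase o).erase k).card : ℤ) ≤ s k := by
      rw [Finset.card_eq_sum_ones]
      push_cast
      calc ∑ j ∈ ((z l).erase o).erase k, (1 : ℤ)
          ≤ ∑ j ∈ ((z l).erase o).erase k, max (Q k j - 1) 0 := by
            refine Finset.sum_le_sum fun j hj => ?_
            simp only [z, Finset.mem_erase, Finset.mem_filter] at hj
            obtain ⟨hjk, hjo, ⟨hjl, hjB⟩, hlj⟩ := hj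
            have h2 := indep l hl k hkB j hjB (Ne.symm hkl) (Ne.symm hjl) (Ne.symm hjk) hlk hlj
            have h3 := hcon l hl k hkB j hjB hlo hko hjo (Ne.symm hkl) (Ne.symm hjl)
              (Ne.symm hjk) hlk hlj
            have h4 := nonneg k hkB j hjB (Ne.symm hjk)
            exact le_max_of_le_left (by omega)
        _ ≤ s k := by
            refine Finset.sum_le_sum_of_subset_of_nonneg ?_ fun _ _ _ => le_max_right _ _
            intro j hj
            simp only [z, Finset.mem_erase, Finset.mem_filter] at hj ⊢
            exact ⟨hj.1, hj.2.2.1.2⟩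
    have hmem : k ∈ (z l).erase o := by
      simp only [z, Finset.mem_erase, Finset.mem_filter]
      exact ⟨hko, ⟨hkl, hkB⟩, hlk⟩
    have := Finset.card_erase_add_one hmem
    omega
  have hl : ∃ l ∈ B, l ≠ o := by
    obtain ⟨l, hl⟩ := hB
    by_cases hlo : l = o
    · have h1 : (B.erase l).Nonempty := by
        by_contra h
        rw [Finset.not_nonempty_iff_eq_empty] at h
        have := sum_le l hl
        simp [h] at this
      obtain ⟨j, hj⟩ := h1
      exact ⟨j, Finset.mem_of_mem_erase hj, fun h => Finset.ne_of_mem_erase hj (h.trans hlo.symm)⟩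
    · exact ⟨l, hl, hlo⟩
  obtain ⟨l, hl, hlo⟩ := hl
  have snn : ∀ l, 0 ≤ s l := fun l => Finset.sum_nonneg fun _ _ => le_max_right _ _
  have hne : ((z l).erase o).Nonempty := by
    rw [← Finset.card_pos]
    have h1 := Finset.pred_card_le_card_erase (s := z l) (a := o)
    have h2 := hsz l hl
    have h3 := snn l
    omega
  obtain ⟨k, hk⟩ := hne
  have hk' := hk
  simp only [z, Finset.mem_erase, Finset.mem_filter] at hk'
  obtain ⟨hko, ⟨hkl, hkB⟩, hlk⟩ := hk'
  have hlz : l ∈ (z k).erase o := by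
    simp only [z, Finset.mem_erase, Finset.mem_filter]
    exact ⟨hlo, ⟨Ne.symm hkl, hl⟩, by rw [symm]; exact hlk⟩
  have h1 := key l hl hlo k hk
  have h2 := key k hkB hko l hlz
  have h3 := hsz l hl
  have h4 := hsz k hkB
  have h5 : o ∉ z l ∨ o ∉ z k := by
    by_contra h
    push Not at h
    obtain ⟨ha, hb⟩ := h
    simp only [z, Finset.mem_erase, Finset.mem_filter] at ha hb
    exact indep l hl k hkB o ha.1.2 (Ne.symm hkl) hlo hko hlk ha.2 hb.2
  have h6 := Finset.pred_card_le_card_erase (s := z l) (a := o)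
  have h7 := Finset.pred_card_le_card_erase (s := z k) (a := o)
  rcases h5 with h | h
  · rw [Finset.erase_eq_of_notMem h] at h1
    omega
  · rw [Finset.erase_eq_of_notMem h] at h2
    omega

/-- The pairs of weight different from `1` form a matching, so a greedy choice discards at most one
vertex for each vertex kept. -/
theorem exists_unitClique {Q : ι → ι → ℤ} (symm : ∀ i j, Q i j = Q j i) (n : ℕ) :
    ∀ U : Finset ι, (∀ a ∈ U, (U.filter fun j => j ≠ a ∧ Q a j ≠ 1).card ≤ 1) →
      2 * n ≤ U.card + 1 → ∃ s ⊆ U, s.card = n ∧ IsUnitClique Q s := by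
  induction n with
  | zero => exact fun U _ _ => ⟨∅, by simp, by simp, by simp [IsUnitClique]⟩
  | succ n ih =>
    intro U hU hc
    obtain ⟨a, ha⟩ : U.Nonempty := by rw [← Finset.card_pos]; omega
    let U' := U.filter fun j => j ≠ a ∧ Q a j = 1
    have hsub : U' ⊆ U := Finset.filter_subset _ _
    have hcard : U.card ≤ U'.card + 2 := by
      have h1 : U ⊆ insert a (U' ∪ U.filter fun j => j ≠ a ∧ Q a j ≠ 1) := by
        intro j hj
        simp only [U', Finset.mem_insert, Finset.mem_union, Finset.mem_filter]
        tauto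
      have h2 := Finset.card_le_card h1
      have h3 := Finset.card_insert_le a (U' ∪ U.filter fun j => j ≠ a ∧ Q a j ≠ 1)
      have h4 := Finset.card_union_le U' (U.filter fun j => j ≠ a ∧ Q a j ≠ 1)
      have h5 := hU a ha
      omega
    obtain ⟨s, hs, hsc, hsQ⟩ := ih U' (fun b hb => (Finset.card_le_card
      (Finset.filter_subset_filter _ hsub)).trans (hU b (hsub hb))) (by omega)
    have has : a ∉ s := fun h => by simpa [U'] using hs h
    refine ⟨insert a s, Finset.insert_subset ha (hs.trans hsub),
      by rw [Finset.card_insert_of_notMem has, hsc], ?_⟩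
    have hQa : ∀ j ∈ s, Q a j = 1 := fun j hj => (Finset.mem_filter.1 (hs hj)).2.2
    intro i hi j hj hij
    rw [Finset.mem_insert] at hi hj
    rcases hi with rfl | hi
    · rcases hj with rfl | hj
      · exact absurd rfl hij
      · exact hQa j hj
    · rcases hj with rfl | hj
      · rw [symm]; exact hQa i hi
      · exact hsQ i hi j hj hij

/-- The numerical data of a star: `A` is a clique, `B` has no independent triple, and there are
no three mutually orthogonal cliques on which the star form is not positive. -/
structure IsStar (Q : ι → ι → ℤ) (A B : Finset ι) : Prop where
  symm : ∀ i j, Q i j = Q j i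
  disj : Disjoint A B
  nonneg : ∀ i ∈ A ∪ B, ∀ j ∈ A ∪ B, i ≠ j → 0 ≤ Q i j
  nonempty : B.Nonempty
  clique : ∀ i ∈ A, ∀ j ∈ A, i ≠ j → 1 ≤ Q i j
  indep : ∀ i ∈ B, ∀ j ∈ B, ∀ k ∈ B, i ≠ j → i ≠ k → j ≠ k →
    Q i j = 0 → Q i k = 0 → Q j k ≠ 0
  sum_le : ∀ l ∈ B, ∑ j ∈ B.erase l, (Q l j - 1) ≤ -2
  arms : ∀ s₁ ⊆ A ∪ B, ∀ s₂ ⊆ A ∪ B, ∀ s₃ ⊆ A ∪ B, IsUnitClique Q s₁ → IsUnitClique Q s₂ →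
    IsUnitClique Q s₃ → Orthogonal Q s₁ s₂ → Orthogonal Q s₁ s₃ → Orthogonal Q s₂ s₃ →
    ∀ c a₁ a₂ a₃ : ℕ, 0 < c →
    0 < 2 * (c : ℤ) ^ 2 - 2 * c * (a₁ * s₁.card + a₂ * s₂.card + a₃ * s₃.card)
      + a₁ ^ 2 * (s₁.card * (s₁.card + 1)) + a₂ ^ 2 * (s₂.card * (s₂.card + 1))
      + a₃ ^ 2 * (s₃.card * (s₃.card + 1))

namespace IsStar

variable {Q : ι → ι → ℤ} {A B : Finset ι}

theorem pair_clique (h : IsStar Q A B) {i j : ι} (hij : Q i j = 1) : IsUnitClique Q {i, j} := by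
  intro a ha b hb hab
  simp only [Finset.mem_insert, Finset.mem_singleton] at ha hb
  have := h.symm i j
  rcases ha with rfl | rfl <;> rcases hb with rfl | rfl <;> simp_all

theorem false_of_orthogonal_five (h : IsStar Q A B) {s : Finset ι} (hs : s ⊆ A)
    (hcard : s.card = 5) (hsQ : IsUnitClique Q s) (hsB : Orthogonal Q s B) : False := by
  obtain ⟨l, hl, k, hk, k', hk', -, -, -, hlk, hlk', hkk', h1, h2, h3⟩ :=
    exists_path_avoiding h.symm (fun i hi j hj => h.nonneg i (Finset.mem_union_right _ hi) j
      (Finset.mem_union_right _ hj)) h.nonempty h.sum_le h.indep h.nonempty.choose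
  -- Cliques of sizes 1, 2, 5 give the star with those arm lengths, the extended diagram of E8; the
  -- coefficients 6, 3, 2, 1 give its radical vector, where the form vanishes.
  have := h.arms {l} (by simp [hl]) {k, k'}
    (by simp [Finset.insert_subset_iff, hk, hk']) s
    (hs.trans Finset.subset_union_left) (by simp [IsUnitClique]) (h.pair_clique h3) hsQ
    (by simp [Orthogonal, h1, h2])
    (fun i hi j hj => by rw [Finset.mem_singleton.1 hi, h.symm]; exact hsB j hj l hl)
    (fun i hi j hj => by
      rw [h.symm]
      refine hsB j hj i ?_
      simp only [Finset.mem_insert, Finset.mem_singleton] at hi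
      rcases hi with rfl | rfl <;> assumption) 6 3 2 1 (by norm_num)
  rw [Finset.card_pair hkk', hcard] at this
  norm_num at this

theorem false_of_exact (h : IsStar Q A B) (hA : 5 ≤ A.card)
    (excess : ∀ a ∈ A, ∑ j ∈ A.erase a, (Q a j - 1) + ∑ l ∈ B, Q a l ≤ 0) : False := by
  have hterm : ∀ a ∈ A, (∀ j ∈ A.erase a, 0 ≤ Q a j - 1) ∧ ∀ l ∈ B, 0 ≤ Q a l := by
    intro a ha
    refine ⟨fun j hj => ?_, fun l hl => ?_⟩
    · have := h.clique a ha j (Finset.mem_of_mem_erase hj) (Finset.ne_of_mem_erase hj).symm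
      omega
    · exact h.nonneg a (Finset.mem_union_left _ ha) l (Finset.mem_union_right _ hl)
        fun e => Finset.disjoint_left.1 h.disj ha (e ▸ hl)
  obtain ⟨s, hs, hcard⟩ := Finset.exists_subset_card_eq hA
  refine h.false_of_orthogonal_five hs hcard (fun i hi j hj hij => ?_) fun i hi l hl => ?_
  · have h1 := hterm i (hs hi)
    have h2 := Finset.single_le_sum h1.1 (Finset.mem_erase.2 ⟨hij.symm, hs hj⟩)
    have h3 := Finset.sum_nonneg h1.2
    have h4 := excess i (hs hi)
    have h5 := h1.1 j (Finset.mem_erase.2 ⟨hij.symm, hs hj⟩)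
    omega
  · have h1 := hterm i (hs hi)
    have h2 := Finset.single_le_sum h1.2 hl
    have h3 := Finset.sum_nonneg h1.1
    have h4 := excess i (hs hi)
    have h5 := h1.2 l hl
    omega

/-- Each `a` in `A` has at most one defect: a non-unit weight inside `A`, or one unit edge into `B`.
If no edge joins `A` to `B`, nine vertices leave a unit clique of size five and type E8 appears. If
an edge `a`–`l` exists, the exchange hypotheses control `l`, and type E7 or E6 appears, according to
whether `l` is orthogonal to the centre `t` of a path in `B`. -/
theorem false_of_excess_le_one (h : IsStar Q A B) (hA : 9 ≤ A.card)
    (excess : ∀ a ∈ A, ∑ j ∈ A.erase a, (Q a j - 1) + ∑ l ∈ B, Q a l ≤ 1)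
    (exchange_le : ∀ a ∈ A, ∀ l ∈ B, Q a l = 1 → ∀ k ∈ B, k ≠ l → Q l k ≤ Q a k + 1)
    (exchange_clique : ∀ a ∈ A, ∀ l ∈ B, Q a l = 1 → ∀ k ∈ B, ∀ k' ∈ B, k ≠ l → k' ≠ l → k ≠ k' →
      Q l k = Q a k + 1 → Q l k' = Q a k' + 1 → 1 ≤ Q k k')
    (exchange_mixed : ∀ a ∈ A, ∀ l ∈ B, Q a l = 1 → ∀ k ∈ B, ∀ a' ∈ A, k ≠ l → a' ≠ a →
      Q l k = Q a k + 1 → Q a a' = Q l a' → 1 ≤ Q k a') : False := by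
  have hAB : ∀ a ∈ A, ∀ l ∈ B, a ≠ l := fun a ha l hl e =>
    Finset.disjoint_left.1 h.disj ha (e ▸ hl)
  have hBn : ∀ i ∈ B, ∀ j ∈ B, i ≠ j → 0 ≤ Q i j := fun i hi j hj =>
    h.nonneg i (Finset.mem_union_right _ hi) j (Finset.mem_union_right _ hj)
  have hterm : ∀ a ∈ A, (∀ j ∈ A.erase a, 0 ≤ Q a j - 1) ∧ ∀ l ∈ B, 0 ≤ Q a l := by
    intro a ha
    refine ⟨fun j hj => ?_, fun l hl => ?_⟩
    · have := h.clique a ha j (Finset.mem_of_mem_erase hj) (Finset.ne_of_mem_erase hj).symm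
      omega
    · exact h.nonneg a (Finset.mem_union_left _ ha) l (Finset.mem_union_right _ hl) (hAB a ha l hl)
  have hle : ∀ a ∈ A, ∀ l ∈ B, Q a l ≤ 1 := by
    intro a ha l hl
    have h2 := Finset.single_le_sum (hterm a ha).2 hl
    have h3 := Finset.sum_nonneg (hterm a ha).1
    have h4 := excess a ha
    omega
  have hone : ∀ a ∈ A, ∀ l ∈ B, Q a l = 1 → (∀ k ∈ B, k ≠ l → Q a k = 0) ∧
      ∀ j ∈ A, j ≠ a → Q a j = 1 := by
    intro a ha l hl hal
    have h4 := excess a ha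
    rw [← Finset.add_sum_erase B _ hl] at h4
    have hB' : ∀ k ∈ B.erase l, 0 ≤ Q a k := fun k hk =>
      (hterm a ha).2 k (Finset.mem_of_mem_erase hk)
    have h5 := Finset.sum_nonneg hB'
    have h6 := Finset.sum_nonneg (hterm a ha).1
    refine ⟨fun k hk hkl => ?_, fun j hj hja => ?_⟩
    · have hk' := Finset.mem_erase.2 ⟨hkl, hk⟩
      have h7 := Finset.single_le_sum hB' hk'
      have h8 := hB' k hk'
      omega
    · have hj' := Finset.mem_erase.2 ⟨hja, hj⟩
      have h7 := Finset.single_le_sum (hterm a ha).1 hj'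
      have h8 := (hterm a ha).1 j hj'
      omega
  have hmatch : ∀ a ∈ A, (A.filter fun j => j ≠ a ∧ Q a j ≠ 1).card ≤ 1 := by
    intro a ha
    have h1 : ((A.filter fun j => j ≠ a ∧ Q a j ≠ 1).card : ℤ) ≤
        ∑ j ∈ A.erase a, (Q a j - 1) := by
      rw [Finset.card_eq_sum_ones]
      push_cast
      refine le_trans (Finset.sum_le_sum (g := fun j => Q a j - 1) fun j hj => ?_)
        (Finset.sum_le_sum_of_subset_of_nonneg ?_ fun j hj _ => (hterm a ha).1 j hj)
      · simp only [Finset.mem_filter] at hj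
        have := h.clique a ha j hj.1 (Ne.symm hj.2.1)
        have := hj.2.2
        omega
      · intro j hj
        simp only [Finset.mem_filter] at hj
        exact Finset.mem_erase.2 ⟨hj.2.1, hj.1⟩
    have h3 := Finset.sum_nonneg (hterm a ha).2
    have h4 := excess a ha
    omega
  -- Two neighbours in `A` would make `l` orthogonal to the rest of `B`. The rest then has pairwise
  -- weights at least `1`, so the sum at any of its vertices is at least `-1`.
  have hload : ∀ l ∈ B, ∀ a ∈ A, ∀ a' ∈ A, a ≠ a' → Q a l = 1 → Q a' l = 1 → False := by
    intro l hl a ha a' ha' haa hal hal'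
    have h1 := hone a ha l hl hal
    have h2 := hone a' ha' l hl hal'
    have hzero : ∀ k ∈ B, k ≠ l → Q l k = 0 := by
      intro k hk hkl
      have h3 := exchange_le a ha l hl hal k hk hkl
      rw [h1.1 k hk hkl] at h3
      have h4 := hBn l hl k hk (Ne.symm hkl)
      by_contra h5
      have h6 := exchange_mixed a ha l hl hal k hk a' ha' hkl (Ne.symm haa)
        (by rw [h1.1 k hk hkl]; omega) (by rw [h1.2 a' ha' (Ne.symm haa), h.symm l, hal'])
      rw [h.symm, h2.1 k hk hkl] at h6
      omega
    have hne : (B.erase l).Nonempty := by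
      by_contra h3
      rw [Finset.not_nonempty_iff_eq_empty] at h3
      have := h.sum_le l hl
      simp [h3] at this
    obtain ⟨k, hk⟩ := hne
    have hkl := Finset.ne_of_mem_erase hk
    have hkB := Finset.mem_of_mem_erase hk
    have h3 := h.sum_le k hkB
    rw [← Finset.add_sum_erase _ _ (Finset.mem_erase.2 ⟨Ne.symm hkl, hl⟩), h.symm k l,
      hzero k hkB hkl] at h3
    have h4 : 0 ≤ ∑ j ∈ (B.erase k).erase l, (Q k j - 1) := by
      refine Finset.sum_nonneg fun j hj => ?_
      simp only [Finset.mem_erase] at hj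
      have h5 := h.indep l hl k hkB j hj.2.2 (Ne.symm hkl) (Ne.symm hj.1) (Ne.symm hj.2.1)
        (hzero k hkB hkl) (hzero j hj.2.2 hj.1)
      have h6 := hBn k hkB j hj.2.2 (Ne.symm hj.2.1)
      omega
    omega
  by_cases hex : ∃ a ∈ A, ∃ l ∈ B, Q a l = 1
  · obtain ⟨a, ha, l, hl, hal⟩ := hex
    have h1 := hone a ha l hl hal
    have hl01 : ∀ k ∈ B, k ≠ l → Q l k = 0 ∨ Q l k = 1 := by
      intro k hk hkl
      have h3 := exchange_le a ha l hl hal k hk hkl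
      rw [h1.1 k hk hkl] at h3
      have h4 := hBn l hl k hk (Ne.symm hkl)
      omega
    have hnbr : ∀ k ∈ B, ∀ k' ∈ B, k ≠ l → k' ≠ l → k ≠ k' → Q l k = 1 → Q l k' = 1 →
        Q k k' ≠ 0 := by
      intro k hk k' hk' hkl hkl' hkk h2 h3
      have := exchange_clique a ha l hl hal k hk k' hk' hkl hkl' hkk
        (by rw [h1.1 k hk hkl, h2]; rfl) (by rw [h1.1 k' hk' hkl', h3]; rfl)
      omega
    obtain ⟨t, ht, k, hk, k', hk', htl, hkl, hkl', htk, htk', hkk', h2, h3, h4⟩ :=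
      exists_path_avoiding h.symm hBn h.nonempty h.sum_le h.indep l
    have hfil : ∀ y ∈ B, (A.filter fun a => Q a y ≠ 0).card ≤ 1 := by
      intro y hy
      rw [Finset.card_le_one]
      intro b hb b' hb'
      simp only [Finset.mem_filter] at hb hb'
      by_contra hbb
      have h5 := (hterm b hb.1).2 y hy
      have h6 := (hterm b' hb'.1).2 y hy
      have h7 := hle b hb.1 y hy
      have h8 := hle b' hb'.1 y hy
      exact hload y hy b hb.1 b' hb'.1 hbb (by omega) (by omega)
    let U := A.filter fun a => Q a l = 0 ∧ Q a t = 0 ∧ Q a k = 0 ∧ Q a k' = 0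
    have hUA : U ⊆ A := Finset.filter_subset _ _
    -- Each of the four vertices of `B` excludes at most one of the nine vertices of `A`.
    have hU : 5 ≤ U.card := by
      have h5 : A ⊆ U ∪ ((A.filter fun a => Q a l ≠ 0) ∪ (A.filter fun a => Q a t ≠ 0) ∪
          (A.filter fun a => Q a k ≠ 0) ∪ (A.filter fun a => Q a k' ≠ 0)) := by
        intro j hj
        simp only [U, Finset.mem_union, Finset.mem_filter]
        tauto
      have h6 := Finset.card_le_card h5
      have h7 := Finset.card_union_le U ((A.filter fun a => Q a l ≠ 0) ∪
          (A.filter fun a => Q a t ≠ 0) ∪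
          (A.filter fun a => Q a k ≠ 0) ∪ (A.filter fun a => Q a k' ≠ 0))
      have h8 := Finset.card_union_le ((A.filter fun a => Q a l ≠ 0) ∪
          (A.filter fun a => Q a t ≠ 0) ∪
          (A.filter fun a => Q a k ≠ 0)) (A.filter fun a => Q a k' ≠ 0)
      have h9 := Finset.card_union_le ((A.filter fun a => Q a l ≠ 0) ∪
          (A.filter fun a => Q a t ≠ 0)) (A.filter fun a => Q a k ≠ 0)
      have h10 := Finset.card_union_le (A.filter fun a => Q a l ≠ 0)
          (A.filter fun a => Q a t ≠ 0)
      have h11 := hfil l hl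
      have h12 := hfil t ht
      have h13 := hfil k hk
      have h14 := hfil k' hk'
      omega
    have hUmatch : ∀ b ∈ U, (U.filter fun j => j ≠ b ∧ Q b j ≠ 1).card ≤ 1 := fun b hb =>
      (Finset.card_le_card (Finset.filter_subset_filter _ hUA)).trans (hmatch b (hUA hb))
    obtain ⟨s, hs, hcard, hsQ⟩ := exists_unitClique h.symm 3 U hUmatch (by omega)
    have hsU : ∀ j ∈ s, Q l j = 0 ∧ Q t j = 0 ∧ Q k j = 0 ∧ Q k' j = 0 := by
      intro j hj
      have := (Finset.mem_filter.1 (hs hj)).2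
      rw [h.symm l, h.symm t, h.symm k, h.symm k']
      exact this
    have hsAB : s ⊆ A ∪ B := (hs.trans hUA).trans Finset.subset_union_left
    rcases hl01 t ht htl with h5 | h5
    · have h6 : Q l k = 1 := (hl01 k hk hkl).resolve_left fun h6 =>
        h.indep l hl t ht k hk (Ne.symm htl) (Ne.symm hkl) htk h5 h6 h2
      have h7 : Q l k' = 1 := (hl01 k' hk' hkl').resolve_left fun h7 =>
        h.indep l hl t ht k' hk' (Ne.symm htl) (Ne.symm hkl') htk' h5 h7 h3
      -- Arms of lengths 1, 3, 3: extended type E7, with radical vector 4; 2, 1, 1.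
      have := h.arms {t} (by simp [ht]) {l, k, k'}
        (by simp [Finset.insert_subset_iff, hl, hk, hk']) s hsAB (by simp [IsUnitClique])
        (by
          have e1 := h.symm l k
          have e2 := h.symm l k'
          have e3 := h.symm k k'
          intro i hi j hj hij
          simp only [Finset.mem_insert, Finset.mem_singleton] at hi hj
          rcases hi with rfl | rfl | rfl <;> rcases hj with rfl | rfl | rfl <;>
            first | exact absurd rfl hij | omega)
        hsQ (by simp [Orthogonal, h2, h3, h.symm t l, h5])
        (by simpa [Orthogonal] using fun j hj => (hsU j hj).2.1)
        (by
          intro i hi j hj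
          have := hsU j hj
          simp only [Finset.mem_insert, Finset.mem_singleton] at hi
          rcases hi with rfl | rfl | rfl <;> tauto) 4 2 1 1 (by norm_num)
      rw [hcard, Finset.card_eq_three.2 ⟨l, k, k', Ne.symm hkl, Ne.symm hkl', hkk', rfl⟩] at this
      norm_num at this
    · have h6 : Q l k = 0 := (hl01 k hk hkl).resolve_right fun h6 =>
        hnbr t ht k hk htl hkl htk h5 h6 h2
      have h7 : Q l k' = 0 := (hl01 k' hk' hkl').resolve_right fun h7 =>
        hnbr t ht k' hk' htl hkl' htk' h5 h7 h3
      obtain ⟨r, hr, hrcard⟩ := Finset.exists_subset_card_eq (s := s) (n := 2) (by omega)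
      -- Arms of lengths 2, 2, 2: extended type E6, with radical vector 3; 1, 1, 1.
      have := h.arms {l, t} (by simp [Finset.insert_subset_iff, hl, ht]) {k, k'}
        (by simp [Finset.insert_subset_iff, hk, hk']) r (hr.trans hsAB) (h.pair_clique h5)
        (h.pair_clique h4) (fun i hi j hj => hsQ i (hr hi) j (hr hj))
        (by simp [Orthogonal, h2, h3, h6, h7])
        (by
          intro i hi j hj
          have := hsU j (hr hj)
          simp only [Finset.mem_insert, Finset.mem_singleton] at hi
          rcases hi with rfl | rfl <;> tauto)
        (by
          intro i hi j hj
          have := hsU j (hr hj)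
          simp only [Finset.mem_insert, Finset.mem_singleton] at hi
          rcases hi with rfl | rfl <;> tauto) 3 1 1 1 (by norm_num)
      rw [hrcard, Finset.card_pair (Ne.symm htl), Finset.card_pair hkk'] at this
      norm_num at this
  · obtain ⟨s, hs, hcard, hsQ⟩ := exists_unitClique h.symm 5 A hmatch (by omega)
    refine h.false_of_orthogonal_five hs hcard hsQ fun i hi l hl => ?_
    have h5 := (hterm i (hs hi)).2 l hl
    have h6 := hle i (hs hi) l hl
    have h7 : Q i l ≠ 1 := fun h7 => hex ⟨i, hs hi, l, hl, h7⟩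
    omega

end IsStar

end CliqueWeights

/-! ### Unit forms that are positive on the kernel of a functional -/

section ConeForm

set_option linter.unusedSectionVars false

variable {V : Type*} [Fintype V] [DecidableEq V]

theorem LinearMap.apply_eq_sum_single (f : (V → ℤ) →ₗ[ℤ] ℤ) (y : V → ℤ) :
    f y = ∑ i, y i * f (Pi.single i 1) := by
  conv_lhs => rw [pi_eq_sum_univ' y, map_sum]
  exact Finset.sum_congr rfl fun i _ => by rw [map_smul, smul_eq_mul]

theorem LinearMap.apply_nonneg_of_single {f : (V → ℤ) →ₗ[ℤ] ℤ}
    (hf : ∀ i, 0 ≤ f (Pi.single i 1)) {y : V → ℤ} (hy : 0 ≤ y) : 0 ≤ f y := by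
  rw [f.apply_eq_sum_single]
  exact Finset.sum_nonneg fun i _ => mul_nonneg (hy i) (hf i)

theorem Pi.single_one_le {x : V → ℤ} (hx : 0 ≤ x) {i : V} (hi : 0 < x i) :
    Pi.single i 1 ≤ x := by
  intro j
  rcases eq_or_ne j i with rfl | hij
  · rw [Pi.single_eq_same]
    exact Int.add_one_le_of_lt hi
  · simpa [hij] using hx j

namespace IntForm

/-- `q` is an integral unit form with polar form `B`. -/
structure IsUnitForm (q : (V → ℤ) → ℤ) (B : LinearMap.BilinForm ℤ (V → ℤ)) : Prop where
  symm : ∀ x y, B x y = B y x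
  two_mul : ∀ x, 2 * q x = B x x
  unit : ∀ i, q (Pi.single i 1) = 1

namespace IsUnitForm

variable {q : (V → ℤ) → ℤ} {B : LinearMap.BilinForm ℤ (V → ℤ)}

theorem map_add (h : IsUnitForm q B) (x y : V → ℤ) : q (x + y) = q x + q y + B x y := by
  have h1 := h.two_mul (x + y)
  have h2 := h.two_mul x
  have h3 := h.two_mul y
  have h4 := h.symm x y
  simp only [_root_.map_add, LinearMap.add_apply] at h1
  omega

theorem map_sub (h : IsUnitForm q B) (x y : V → ℤ) : q (x - y) = q x + q y - B x y := by
  have h1 := h.two_mul (x - y)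
  have h2 := h.two_mul x
  have h3 := h.two_mul y
  have h4 := h.symm x y
  simp only [_root_.map_sub, LinearMap.sub_apply] at h1
  omega

theorem map_zero (h : IsUnitForm q B) : q 0 = 0 := by
  have := h.two_mul 0
  simpa using this

theorem map_smul (h : IsUnitForm q B) (n : ℤ) (x : V → ℤ) : q (n • x) = n ^ 2 * q x := by
  have h1 := h.two_mul (n • x)
  have h2 := h.two_mul x
  simp only [_root_.map_smul, LinearMap.smul_apply, smul_eq_mul] at h1
  have h3 : 2 * q (n • x) = 2 * (n ^ 2 * q x) := by linear_combination h1 - n ^ 2 * h2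
  omega

theorem isotropic_nonneg (h : IsUnitForm q B) (hq : IsWeaklyNonneg q) {z y : V → ℤ} (hz : 0 ≤ z)
    (hqz : q z = 0) (hy : 0 ≤ y) : 0 ≤ B z y := by
  refine LinearMap.apply_nonneg_of_single (f := B z) (fun i => ?_) hy
  -- The factor `2` matters: `1 + 2 * B z e_i ≥ 0` forces `B z e_i ≥ 0` over the integers, while `z
  -- + e_i` would only give `-1`.
  have h1 := hq ((2 : ℤ) • z + Pi.single i 1)
    (add_nonneg (smul_nonneg (by norm_num) hz) (Pi.single_nonneg.2 zero_le_one))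
  rw [h.map_add, h.map_smul, h.unit, hqz, LinearMap.map_smul, LinearMap.smul_apply,
    smul_eq_mul] at h1
  omega

theorem isotropic_eq_zero (h : IsUnitForm q B) (hq : IsWeaklyNonneg q) {z y : V → ℤ} (hz : 0 ≤ z)
    (hqz : q z = 0) (hy : 0 ≤ y) (hyz : y ≤ z) : B z y = 0 := by
  have h1 := h.isotropic_nonneg hq hz hqz hy
  have h2 := h.isotropic_nonneg hq hz hqz (sub_nonneg.2 hyz)
  have h3 := h.two_mul z
  rw [_root_.map_sub] at h2
  omega

/-- A decomposition of `y` into finitely many roots. -/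
def IsRootDecomposition (q : (V → ℤ) → ℤ) (y : V → ℤ) (I : Finset ℕ) (w : ℕ → V → ℤ) : Prop :=
  (∀ i ∈ I, IsRoot q (w i)) ∧ ∑ i ∈ I, w i = y

theorem exists_rootDecomposition (h : IsUnitForm q B) (n : ℕ) :
    ∀ y : V → ℤ, 0 ≤ y → ∑ i, y i = n → ∃ I w, IsRootDecomposition q y I w := by
  induction n with
  | zero =>
    intro y hy hs
    refine ⟨∅, 0, by simp, ?_⟩
    have h1 := (Finset.sum_eq_zero_iff_of_nonneg fun i _ => hy i).1 hs
    ext i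
    simpa using (h1 i (Finset.mem_univ i)).symm
  | succ n ih =>
    intro y hy hs
    obtain ⟨j, hj⟩ : ∃ j, 0 < y j := by
      by_contra hcon
      push Not at hcon
      have := Finset.sum_nonpos fun i (_ : i ∈ Finset.univ) => hcon i
      push_cast at hs
      omega
    have hle := Pi.single_one_le hy hj
    obtain ⟨I, w, hw, hsum⟩ := ih (y - Pi.single j 1) (sub_nonneg.2 hle) (by
      simp only [Pi.sub_apply, Finset.sum_sub_distrib, hs, Finset.sum_pi_single',
        Finset.mem_univ, if_true]
      push_cast
      ring)
    obtain ⟨k, hk⟩ := Infinite.exists_notMem_finset I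
    have hne : ∀ i ∈ I, i ≠ k := fun i hi e => hk (e ▸ hi)
    refine ⟨insert k I, Function.update w k (Pi.single j 1), fun i hi => ?_, ?_⟩
    · rcases Finset.mem_insert.1 hi with rfl | hi
      · rw [Function.update_self]
        exact ⟨Pi.single_nonneg.2 zero_le_one, h.unit j⟩
      · rw [Function.update_of_ne (hne i hi)]
        exact hw i hi
    · rw [Finset.sum_insert hk, Function.update_self,
        Finset.sum_congr rfl fun i hi => Function.update_of_ne (hne i hi) _ _, hsum]
      abel

theorem IsRootDecomposition.le {y : V → ℤ} {I J : Finset ℕ} {w : ℕ → V → ℤ}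
    (h : IsRootDecomposition q y I w) (hJ : J ⊆ I) : ∑ i ∈ J, w i ≤ y := by
  rw [← h.2]
  exact Finset.sum_le_sum_of_subset_of_nonneg hJ fun i hi _ => (h.1 i hi).1

/-- If `q` is positive below `y`, then `y` is a sum of roots whose pairwise polar products are
non-negative. -/
theorem exists_rootDecomposition_nonneg (h : IsUnitForm q B) {y : V → ℤ} (hy : 0 ≤ y)
    (hpos : ∀ z, 0 ≤ z → z ≤ y → z ≠ 0 → 1 ≤ q z) :
    ∃ I w, IsRootDecomposition q y I w ∧ ∀ i ∈ I, ∀ j ∈ I, i ≠ j → 0 ≤ B (w i) (w j) := by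
  classical
  have hex : ∃ n : ℕ, ∃ I w, IsRootDecomposition q y I w ∧ I.card = n := by
    obtain ⟨I, w, hIw⟩ := h.exists_rootDecomposition (∑ i, y i).toNat y hy
      (Int.toNat_of_nonneg (Finset.sum_nonneg fun i _ => hy i)).symm
    exact ⟨_, I, w, hIw, rfl⟩
  obtain ⟨I, w, hIw, hcard⟩ := Nat.find_spec hex
  refine ⟨I, w, hIw, fun i hi j hj hij => ?_⟩
  -- In a decomposition with the fewest roots, two roots of negative product could be merged: their
  -- sum has value at most `1`, and at least `1` by positivity.
  by_contra hneg
  have hi' := hIw.1 i hi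
  have hj' := hIw.1 j hj
  have hle := hIw.le (J := {i, j}) (by simp [Finset.insert_subset_iff, hi, hj])
  rw [Finset.sum_pair hij] at hle
  have hne : w i + w j ≠ 0 := by
    intro h0
    have h1 : w i = 0 := le_antisymm (by rw [eq_neg_of_add_eq_zero_left h0]; simpa using hj'.1) hi'.1
    have h2 := hi'.2
    rw [h1, h.map_zero] at h2
    omega
  have hge := hpos _ (add_nonneg hi'.1 hj'.1) hle hne
  have hadd := h.map_add (w i) (w j)
  rw [hi'.2, hj'.2] at hadd
  have hroot : IsRoot q (w i + w j) := ⟨add_nonneg hi'.1 hj'.1, by omega⟩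
  have hlt : (I.erase j).card < Nat.find hex := by
    rw [← hcard]
    exact Finset.card_erase_lt_of_mem hj
  refine Nat.find_min hex hlt ⟨I.erase j, Function.update w i (w i + w j), ⟨fun k hk => ?_, ?_⟩, rfl⟩
  · rcases eq_or_ne k i with rfl | hki
    · rwa [Function.update_self]
    · rw [Function.update_of_ne hki]
      exact hIw.1 k (Finset.mem_of_mem_erase hk)
  · have hiJ : i ∈ I.erase j := Finset.mem_erase.2 ⟨hij, hi⟩
    rw [← hIw.2, ← Finset.add_sum_erase I w hj, ← Finset.add_sum_erase _ _ hiJ,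
      ← Finset.add_sum_erase _ w hiJ, Function.update_self,
      Finset.sum_congr rfl fun k hk => Function.update_of_ne (Finset.ne_of_mem_erase hk) _ _]
    abel

end IsUnitForm

/-- `q` is weakly non-negative, and positive on the non-zero vectors of the positive cone that
are killed by the non-negative functional `φ`. -/
structure IsConeForm (q : (V → ℤ) → ℤ) (B : LinearMap.BilinForm ℤ (V → ℤ))
    (φ : (V → ℤ) →ₗ[ℤ] ℤ) : Prop extends IsUnitForm q B where
  weaklyNonneg : IsWeaklyNonneg q
  functional_nonneg : ∀ y, 0 ≤ y → 0 ≤ φ y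
  pos : ∀ y, 0 ≤ y → φ y = 0 → y ≠ 0 → 1 ≤ q y

theorem isPWO_nonneg : {x : V → ℤ | 0 ≤ x}.IsPWO := by
  have h : (Set.univ.pi fun _ : V => Set.Ici (0 : ℤ)).IsPWO :=
    Set.IsPWO.pi fun _ => Set.isPWO_iff_isWF.2 bddBelow_Ici.isWF
  exact h.mono fun x hx i _ => hx i

namespace IsConeForm

variable {q : (V → ℤ) → ℤ} {B : LinearMap.BilinForm ℤ (V → ℤ)} {φ : (V → ℤ) →ₗ[ℤ] ℤ}

theorem polar_mem_Icc (h : IsConeForm q B φ) {x : V → ℤ} (hx : IsRoot q x) {i : V} (hi : x i ≠ 0) :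
    B x (Pi.single i 1) ∈ Finset.Icc (-2) 2 := by
  have h0 : 0 < x i := lt_of_le_of_ne (hx.1 i) (Ne.symm hi)
  have h1 := h.weaklyNonneg _ (add_nonneg hx.1 (Pi.single_nonneg.2 (zero_le_one (α := ℤ)) : _ ≤ Pi.single i 1))
  have h2 := h.weaklyNonneg _ (sub_nonneg.2 (Pi.single_one_le hx.1 h0))
  rw [h.map_add, hx.2, h.unit] at h1
  rw [h.map_sub, hx.2, h.unit] at h2
  rw [Finset.mem_Icc]
  omega

/-- Finitely many patterns record the products with the `e_i` on the support. Comparable distinct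
roots with the same pattern and the same `φ` would differ by an isotropic vector killed by `φ`; so
each pattern gives an antichain, finite by Dickson's lemma. -/
theorem finite_roots (h : IsConeForm q B φ) (t : ℤ) : {x | IsRoot q x ∧ φ x = t}.Finite := by
  classical
  -- The value `3` lies outside the range `[-2, 2]` of the products, so `F x` determines the
  -- support.
  let F : (V → ℤ) → V → ℤ := fun x i => if x i = 0 then 3 else B x (Pi.single i 1)
  refine Set.Finite.of_finite_fibers F ?_ fun f _ => ?_
  · refine (Fintype.piFinset fun _ : V => Finset.Icc (-2 : ℤ) 3).finite_toSet.subset ?_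
    rintro _ ⟨x, ⟨hx, -⟩, rfl⟩
    simp only [Finset.mem_coe, Fintype.mem_piFinset, F]
    intro i
    split_ifs with hi
    · decide
    · exact Finset.Icc_subset_Icc_right (by norm_num) (h.polar_mem_Icc hx hi)
  · refine IsAntichain.finite_of_partiallyWellOrderedOn (r := (· ≤ ·)) ?_
      (isPWO_nonneg.mono fun x hx => hx.1.1.1)
    rintro x ⟨⟨hx, hxt⟩, hxf⟩ y ⟨⟨hy, hyt⟩, hyf⟩ hxy hle
    have hFF : F x = F y := (show F x = f from hxf).trans (show F y = f from hyf).symm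
    have hB : B (y - x) (y - x) = 0 := by
      rw [(B (y - x)).apply_eq_sum_single]
      refine Finset.sum_eq_zero fun i _ => ?_
      rw [_root_.map_sub, LinearMap.sub_apply, Pi.sub_apply]
      have h1 := congrFun hFF i
      have h2 := fun hi => Finset.mem_Icc.1 (h.polar_mem_Icc hx (i := i) hi)
      have h3 := fun hi => Finset.mem_Icc.1 (h.polar_mem_Icc hy (i := i) hi)
      simp only [F] at h1
      by_cases hxi : x i = 0 <;> by_cases hyi : y i = 0
      · simp [hxi, hyi]
      · have := h3 hyi
        simp only [hxi, hyi, if_true, if_false] at h1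
        omega
      · have := h2 hxi
        simp only [hxi, hyi, if_true, if_false] at h1
        omega
      · simp only [hxi, hyi, if_false] at h1
        rw [h1, sub_self, mul_zero]
    have h0 : q (y - x) = 0 := by
      have := h.two_mul (y - x)
      omega
    have h1 := h.pos (y - x) (sub_nonneg.2 hle) (by rw [_root_.map_sub, hxt, hyt, sub_self])
      (sub_ne_zero.2 (Ne.symm hxy))
    omega

end IsConeForm

end IntForm

end ConeForm

/-! ### Extremal roots and the star of roots around a large coordinate. -/

section ExtremalStar

variable {V : Type*} [Fintype V] [DecidableEq V]

set_option linter.unusedSectionVars false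

namespace IntForm

/-- A root `x` of maximal `p`-coordinate `m` for the given value of `φ`, minimal among these,
together with a decomposition of `x - m e_p` into roots with non-negative polar products. -/
structure IsExtremalStar (q : (V → ℤ) → ℤ) (B : LinearMap.BilinForm ℤ (V → ℤ))
    (φ : (V → ℤ) →ₗ[ℤ] ℤ) (p : V) (m : ℤ) (x : V → ℤ) (I : Finset ℕ) (w : ℕ → V → ℤ) :
    Prop extends IsConeForm q B φ where
  root : IsRoot q x
  coord : x p = m
  three_le : 3 ≤ m
  functional_single : φ (Pi.single p 1) = 0
  pos_of_large : ∀ y, 0 ≤ y → φ y = φ x → m - 2 ≤ y p → 1 ≤ q y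
  maximal : ∀ y, IsRoot q y → φ y = φ x → y p ≤ m
  minimal : ∀ y, IsRoot q y → φ y = φ x → y p = m → y ≤ x → y = x
  box_pos : ∀ z, 0 ≤ z → z ≤ x → z ≠ 0 → 1 ≤ q z
  decomposition : IsUnitForm.IsRootDecomposition q (x - m • Pi.single p 1) I w
  polar_nonneg : ∀ i ∈ I, ∀ j ∈ I, i ≠ j → 0 ≤ B (w i) (w j)

theorem IsConeForm.exists_isExtremalStar {q : (V → ℤ) → ℤ} {B : LinearMap.BilinForm ℤ (V → ℤ)}
    {φ : (V → ℤ) →ₗ[ℤ] ℤ} (h : IsConeForm q B φ) {p : V} {x₀ : V → ℤ} {N : ℤ} (hN : 3 ≤ N)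
    (hx₀ : IsRoot q x₀) (hp : N ≤ x₀ p) (hφ : φ (Pi.single p 1) = 0)
    (large : ∀ y, 0 ≤ y → φ y = φ x₀ → N - 2 ≤ y p → 1 ≤ q y)
    (box : ∀ x, IsRoot q x → φ x = φ x₀ → N ≤ x p → ∀ z, 0 ≤ z → z ≤ x → z ≠ 0 → 1 ≤ q z) :
    ∃ m x I w, N ≤ m ∧ φ x = φ x₀ ∧ IsExtremalStar q B φ p m x I w := by
  obtain ⟨x₁, ⟨hx₁, hx₁φ⟩, hmax⟩ := Set.exists_max_image _ (fun x => x p)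
    (h.finite_roots (φ x₀)) ⟨x₀, hx₀, rfl⟩
  have hN₁ : N ≤ x₁ p := hp.trans (hmax x₀ ⟨hx₀, rfl⟩)
  obtain ⟨x, ⟨⟨hx, hxφ⟩, hxp⟩, hmin⟩ := ((h.finite_roots (φ x₀)).subset
    (Set.sep_subset _ fun x => x p = x₁ p)).exists_minimal ⟨x₁, ⟨hx₁, hx₁φ⟩, rfl⟩
  have hbox := box x hx hxφ (hxp ▸ hN₁)
  have hle : x p • Pi.single p 1 ≤ x := by
    intro j
    rcases eq_or_ne j p with rfl | hj
    · simp
    · simpa [hj] using hx.1 j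
  obtain ⟨I, w, hIw, hnn⟩ := h.exists_rootDecomposition_nonneg (sub_nonneg.2 hle)
    fun z hz hzx => hbox z hz (hzx.trans (sub_le_self _ (smul_nonneg (hx.1 p)
      (Pi.single_nonneg.2 zero_le_one))))
  refine ⟨x p, x, I, w, hxp ▸ hN₁, hxφ, { h with
    root := hx
    coord := rfl
    three_le := hN.trans (hxp ▸ hN₁)
    functional_single := hφ
    pos_of_large := fun y hy hyφ hyp => large y hy (hyφ.trans hxφ) (by omega)
    maximal := fun y hy hyφ => hxp ▸ hmax y ⟨hy, hyφ.trans hxφ⟩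
    minimal := fun y hy hyφ hyp hyx =>
      le_antisymm hyx (hmin ⟨⟨hy, hyφ.trans hxφ⟩, hyp.trans hxp⟩ hyx)
    box_pos := hbox
    decomposition := hIw
    polar_nonneg := hnn }⟩

namespace IsExtremalStar

variable {q : (V → ℤ) → ℤ} {B : LinearMap.BilinForm ℤ (V → ℤ)} {φ : (V → ℤ) →ₗ[ℤ] ℤ} {p : V}
  {m : ℤ} {x : V → ℤ} {I : Finset ℕ} {w : ℕ → V → ℤ}

theorem eq_add_sum (h : IsExtremalStar q B φ p m x I w) :
    x = m • Pi.single p 1 + ∑ i ∈ I, w i := by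
  rw [h.decomposition.2]
  abel

theorem single_nonneg' (p : V) : (0 : V → ℤ) ≤ Pi.single p 1 := Pi.single_nonneg.2 zero_le_one

theorem unit_nonneg (h : IsExtremalStar q B φ p m x I w) {i : ℕ} (hi : i ∈ I) : 0 ≤ w i :=
  (h.decomposition.1 i hi).1

theorem unit_apply (h : IsExtremalStar q B φ p m x I w) {i : ℕ} (hi : i ∈ I) : w i p = 0 := by
  have h1 := congrFun h.decomposition.2 p
  rw [Finset.sum_apply] at h1
  refine (Finset.sum_eq_zero_iff_of_nonneg fun i hi => h.unit_nonneg hi p).1 ?_ i hi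
  rw [h1]
  simp [h.coord]

theorem sub_sum_nonneg (h : IsExtremalStar q B φ p m x I w) {J : Finset ℕ} (hJ : J ⊆ I) {c : ℤ}
    (hc : c ≤ m) : 0 ≤ x - c • Pi.single p 1 - ∑ i ∈ J, w i := by
  have h1 := h.decomposition.le hJ
  have h2 : c • (Pi.single p 1 : V → ℤ) ≤ m • Pi.single p 1 :=
    smul_le_smul_of_nonneg_right hc (single_nonneg' p)
  rw [sub_sub, sub_nonneg]
  calc c • Pi.single p 1 + ∑ i ∈ J, w i ≤ m • Pi.single p 1 + (x - m • Pi.single p 1) :=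
        add_le_add h2 h1
    _ = x := by abel

theorem unit_le (h : IsExtremalStar q B φ p m x I w) {i : ℕ} (hi : i ∈ I) : w i ≤ x := by
  have := h.sub_sum_nonneg (J := {i}) (by simpa using hi) (c := 0) (by have := h.three_le; omega)
  simpa using this

theorem functional_unit (h : IsExtremalStar q B φ p m x I w) {i : ℕ} (hi : i ∈ I) : 0 ≤ φ (w i) :=
  h.functional_nonneg _ (h.unit_nonneg hi)

theorem polar_single_single (h : IsUnitForm q B) (p : V) :
    B (Pi.single p 1) (Pi.single p 1) = 2 := by
  have h1 := h.two_mul (Pi.single p 1)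
  have h2 := h.unit p
  omega

theorem polar_unit_unit (h : IsExtremalStar q B φ p m x I w) {i : ℕ} (hi : i ∈ I) :
    B (w i) (w i) = 2 := by
  have h1 := h.two_mul (w i)
  have h2 := (h.decomposition.1 i hi).2
  omega

theorem polar_root_unit_eq (h : IsExtremalStar q B φ p m x I w) {i : ℕ} (hi : i ∈ I) :
    B x (w i) = 2 + ∑ j ∈ I.erase i, B (w i) (w j) + m * B (w i) (Pi.single p 1) := by
  have h1 : B (w i) x = B (w i) (m • Pi.single p 1 + ∑ i ∈ I, w i) := by rw [← h.eq_add_sum]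
  rw [h.symm, h1, map_add, map_smul, smul_eq_mul, map_sum, ← Finset.add_sum_erase I _ hi,
    h.polar_unit_unit hi]
  ring

theorem polar_root_unit_le_one (h : IsExtremalStar q B φ p m x I w) {i : ℕ} (hi : i ∈ I) :
    B x (w i) ≤ 1 := by
  have h0 := h.three_le
  have h1 := h.sub_sum_nonneg (J := {i}) (by simpa using hi) (c := 0) (by omega)
  simp only [zero_smul, sub_zero, Finset.sum_singleton] at h1
  have h2 := h.box_pos _ h1 (sub_le_self _ (h.unit_nonneg hi)) fun h3 => by
    have := congrFun h3 p
    rw [Pi.sub_apply, h.coord, h.unit_apply hi, Pi.zero_apply] at this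
    omega
  rw [h.map_sub, h.root.2, (h.decomposition.1 i hi).2] at h2
  omega

/-- Positivity at `w i + e_p` gives at least `-1`. A non-negative product would make `B x (w i) ≥
2`, which positivity at `x - w i` forbids. -/
theorem polar_unit_single (h : IsExtremalStar q B φ p m x I w) {i : ℕ} (hi : i ∈ I) :
    B (w i) (Pi.single p 1) = -1 := by
  have h0 := h.three_le
  have h1 := h.sub_sum_nonneg (J := {i}) (by simpa using hi) (c := 1) (by omega)
  simp only [one_smul, Finset.sum_singleton, sub_sub] at h1
  have h2 := h.box_pos _ (add_nonneg (h.unit_nonneg hi) (single_nonneg' p))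
    (by rw [add_comm]; exact sub_nonneg.1 h1) fun h3 => by
      have := congrFun h3 p
      rw [Pi.add_apply, h.unit_apply hi, Pi.zero_apply, Pi.single_eq_same] at this
      omega
  rw [h.map_add, (h.decomposition.1 i hi).2, h.unit] at h2
  have h3 := h.polar_root_unit_le_one hi
  rw [h.polar_root_unit_eq hi] at h3
  have h4 : 0 ≤ ∑ j ∈ I.erase i, B (w i) (w j) := Finset.sum_nonneg fun j hj =>
    h.polar_nonneg i hi j (Finset.mem_of_mem_erase hj) (Finset.ne_of_mem_erase hj).symm
  by_contra h5
  have h6 : 0 ≤ B (w i) (Pi.single p 1) := by omega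
  have := mul_nonneg (by omega : 0 ≤ m) h6
  omega

theorem degree_eq (h : IsExtremalStar q B φ p m x I w) {i : ℕ} (hi : i ∈ I) :
    ∑ j ∈ I.erase i, B (w i) (w j) = B x (w i) + m - 2 := by
  rw [h.polar_root_unit_eq hi, h.polar_unit_single hi]
  ring

theorem polar_root_single (h : IsExtremalStar q B φ p m x I w) :
    B x (Pi.single p 1) = 2 * m - I.card := by
  have h1 : B x (Pi.single p 1) = B (m • Pi.single p 1 + ∑ i ∈ I, w i) (Pi.single p 1) := by
    rw [← h.eq_add_sum]
  rw [h1, map_add, map_smul, map_sum, LinearMap.add_apply, LinearMap.smul_apply,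
    polar_single_single h.toIsUnitForm, LinearMap.sum_apply,
    Finset.sum_congr rfl fun i hi => h.polar_unit_single hi]
  simp
  ring

theorem polar_root_single_mem (h : IsExtremalStar q B φ p m x I w) :
    0 ≤ B x (Pi.single p 1) ∧ B x (Pi.single p 1) ≤ 1 := by
  have h0 := h.three_le
  have h1 := h.pos_of_large (x + Pi.single p 1) (add_nonneg h.root.1 (single_nonneg' p))
    (by rw [map_add, h.functional_single, add_zero])
    (by rw [Pi.add_apply, h.coord, Pi.single_eq_same]; omega)
  have h2 := h.pos_of_large (x - Pi.single p 1)
    (by simpa using h.sub_sum_nonneg (Finset.empty_subset I) (c := 1) (by omega))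
    (by rw [map_sub, h.functional_single, sub_zero])
    (by rw [Pi.sub_apply, h.coord, Pi.single_eq_same]; omega)
  have h3 : q (x + Pi.single p 1) ≠ 1 := fun h3 => by
    have := h.maximal (x + Pi.single p 1) ⟨add_nonneg h.root.1 (single_nonneg' p), h3⟩
      (by rw [map_add, h.functional_single, add_zero])
    rw [Pi.add_apply, h.coord, Pi.single_eq_same] at this
    omega
  rw [h.map_add, h.root.2, h.unit] at h1 h3
  rw [h.map_sub, h.root.2, h.unit] at h2
  omega

theorem sum_polar (h : IsExtremalStar q B φ p m x I w) :
    m * B x (Pi.single p 1) + ∑ i ∈ I, B x (w i) = 2 := by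
  have h1 : B x x = B x (m • Pi.single p 1 + ∑ i ∈ I, w i) := by rw [← h.eq_add_sum]
  rw [map_add, map_smul, map_sum, ← h.two_mul, h.root.2] at h1
  simpa using h1.symm

/-- The value `1` would make `x - w i` a smaller root with the same `p`-coordinate and the same `φ`.
-/
theorem polar_root_unit_mem (h : IsExtremalStar q B φ p m x I w) {i : ℕ} (hi : i ∈ I)
    (hφ : φ (w i) = 0) : B x (w i) = -1 ∨ B x (w i) = 0 := by
  have h0 := h.three_le
  have h1 := h.pos_of_large (x + w i) (add_nonneg h.root.1 (h.unit_nonneg hi))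
    (by rw [map_add, hφ, add_zero]) (by rw [Pi.add_apply, h.coord, h.unit_apply hi]; omega)
  rw [h.map_add, h.root.2, (h.decomposition.1 i hi).2] at h1
  have h2 := h.polar_root_unit_le_one hi
  have h3 : B x (w i) ≠ 1 := fun h3 => by
    have h4 := h.minimal (x - w i) ⟨sub_nonneg.2 (h.unit_le hi), by
      rw [h.map_sub, h.root.2, (h.decomposition.1 i hi).2, h3]; rfl⟩ (by rw [map_sub, hφ, sub_zero])
      (by rw [Pi.sub_apply, h.coord, h.unit_apply hi, sub_zero])
      (sub_le_self _ (h.unit_nonneg hi))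
    have h5 := (h.decomposition.1 i hi).2
    rw [sub_eq_self.1 h4, h.map_zero] at h5
    omega
  omega

/-- If `w i` and `w j` were orthogonal, `x + w i + w j + e_p` would be a root with `p`-coordinate `m
+ 1`. -/
theorem one_le_polar (h : IsExtremalStar q B φ p m x I w) (hp : B x (Pi.single p 1) = 1)
    {i j : ℕ} (hi : i ∈ I) (hj : j ∈ I) (hij : i ≠ j) (hφi : φ (w i) = 0) (hφj : φ (w j) = 0)
    (hxi : B x (w i) = -1) (hxj : B x (w j) = -1) : 1 ≤ B (w i) (w j) := by
  have h1 := h.polar_nonneg i hi j hj hij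
  by_contra h2
  have h3 := h.maximal (x + w i + w j + Pi.single p 1)
    ⟨add_nonneg (add_nonneg (add_nonneg h.root.1 (h.unit_nonneg hi)) (h.unit_nonneg hj))
      (single_nonneg' p), by
        simp only [h.map_add, map_add, LinearMap.add_apply, h.root.2, (h.decomposition.1 i hi).2,
          (h.decomposition.1 j hj).2, h.unit, h.polar_unit_single hi, h.polar_unit_single hj,
          hp, hxi, hxj]
        omega⟩ (by simp [hφi, hφj, h.functional_single])
  simp [h.coord, h.unit_apply hi, h.unit_apply hj] at h3

/-- For an independent triple, `x - w i - w j - w k - 2 e_p` is isotropic. Its `p`-coordinate `m -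
2` explains the threshold in `pos_of_large`. -/
theorem not_independent (h : IsExtremalStar q B φ p m x I w) (hp : B x (Pi.single p 1) = 1)
    {i j k : ℕ} (hi : i ∈ I) (hj : j ∈ I) (hk : k ∈ I) (hij : i ≠ j) (hik : i ≠ k) (hjk : j ≠ k)
    (hφi : φ (w i) = 0) (hφj : φ (w j) = 0) (hφk : φ (w k) = 0)
    (hxi : B x (w i) = 0) (hxj : B x (w j) = 0) (hxk : B x (w k) = 0)
    (h1 : B (w i) (w j) = 0) (h2 : B (w i) (w k) = 0) : B (w j) (w k) ≠ 0 := by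
  intro h3
  have h0 := h.three_le
  have h4 := h.sub_sum_nonneg (J := {i, j, k}) (by simp [Finset.insert_subset_iff, hi, hj, hk])
    (c := 2) (by omega)
  rw [Finset.sum_insert (by simp [hij, hik]), Finset.sum_pair hjk] at h4
  have h5 : x - (2 : ℤ) • Pi.single p 1 - (w i + (w j + w k)) =
      x - w i - w j - w k - (2 : ℤ) • Pi.single p 1 := by abel
  rw [h5] at h4
  have h6 := h.pos_of_large _ h4 (by
      simp only [map_sub, map_smul, hφi, hφj, hφk, h.functional_single, sub_zero, smul_zero])
    (by simp [h.coord, h.unit_apply hi, h.unit_apply hj, h.unit_apply hk])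
  simp only [h.map_sub, map_sub, LinearMap.sub_apply, h.root.2, (h.decomposition.1 i hi).2,
    (h.decomposition.1 j hj).2, (h.decomposition.1 k hk).2, h.map_smul, h.unit, map_smul,
    smul_eq_mul, h.polar_unit_single hi, h.polar_unit_single hj, h.polar_unit_single hk,
    hp, hxi, hxj, hxk, h1, h2, h3] at h6
  norm_num at h6

section Exchange

variable {a l : ℕ}

theorem exchange_isRoot (h : IsExtremalStar q B φ p m x I w) (ha : a ∈ I) (hl : l ∈ I)
    (hxa : B x (w a) = -1) (hxl : B x (w l) = 0)
    (hal : B (w a) (w l) = 1) : IsRoot q (x + w a - w l) := by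
  refine ⟨sub_nonneg.2 ((h.unit_le hl).trans (le_add_of_nonneg_right (h.unit_nonneg ha))), ?_⟩
  simp only [h.map_sub, h.map_add, map_add, LinearMap.add_apply, h.root.2,
    (h.decomposition.1 a ha).2, (h.decomposition.1 l hl).2, hxa, hxl, hal]
  norm_num

/-- The exchanged root `x + w a - w l` has the same `φ` and `p`-coordinate as `x`, but need not be
minimal. The upper bound comes instead from positivity after subtracting `w k + e_p`. -/
theorem exchange_polar_mem (h : IsExtremalStar q B φ p m x I w) (hp : B x (Pi.single p 1) = 1)
    (ha : a ∈ I) (hl : l ∈ I)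
    (hφa : φ (w a) = 0) (hφl : φ (w l) = 0) (hxa : B x (w a) = -1) (hxl : B x (w l) = 0)
    (hal : B (w a) (w l) = 1) {k : ℕ} (hk : k ∈ I) (hkl : k ≠ l) (hφk : φ (w k) = 0) :
    -1 ≤ B x (w k) + B (w a) (w k) - B (w l) (w k) ∧
      B x (w k) + B (w a) (w k) - B (w l) (w k) ≤ 0 := by
  have h0 := h.three_le
  have hr := h.exchange_isRoot ha hl hxa hxl hal
  constructor
  · have h1 := h.pos_of_large (x + w a - w l + w k) (add_nonneg hr.1 (h.unit_nonneg hk))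
      (by simp [hφa, hφl, hφk])
      (by simp [h.coord, h.unit_apply ha, h.unit_apply hl, h.unit_apply hk])
    simp only [h.map_add, hr.2, map_add, map_sub, LinearMap.add_apply, LinearMap.sub_apply,
      (h.decomposition.1 k hk).2] at h1
    have h2 := hr.2
    rw [h.map_sub, h.map_add] at h2
    simp only [map_add, LinearMap.add_apply] at h2
    omega
  · have h4 := h.sub_sum_nonneg (J := {k, l}) (by simp [Finset.insert_subset_iff, hk, hl])
      (c := 1) (by omega)
    rw [Finset.sum_pair hkl] at h4
    have h5 : x + w a - w l - w k - Pi.single p 1 =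
        (x - (1 : ℤ) • Pi.single p 1 - (w k + w l)) + w a := by rw [one_smul]; abel
    have h1 := h.pos_of_large (x + w a - w l - w k - Pi.single p 1)
      (by rw [h5]; exact add_nonneg h4 (h.unit_nonneg ha))
      (by simp [hφa, hφl, hφk, h.functional_single])
      (by simp [h.coord, h.unit_apply ha, h.unit_apply hl, h.unit_apply hk])
    rw [h.map_sub, h.map_sub (x + w a - w l), hr.2] at h1
    simp only [map_add, map_sub, LinearMap.add_apply, LinearMap.sub_apply, h.unit, hp,
      h.polar_unit_single hk, h.polar_unit_single ha, h.polar_unit_single hl,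
      (h.decomposition.1 k hk).2] at h1
    omega

theorem exchange_one_le_polar (h : IsExtremalStar q B φ p m x I w) (hp : B x (Pi.single p 1) = 1)
    (ha : a ∈ I) (hl : l ∈ I)
    (hφa : φ (w a) = 0) (hφl : φ (w l) = 0) (hxa : B x (w a) = -1) (hxl : B x (w l) = 0)
    (hal : B (w a) (w l) = 1) {k j : ℕ} (hk : k ∈ I) (hj : j ∈ I) (hkj : k ≠ j)
    (hφk : φ (w k) = 0) (hφj : φ (w j) = 0)
    (hxk : B x (w k) + B (w a) (w k) - B (w l) (w k) = -1)
    (hxj : B x (w j) + B (w a) (w j) - B (w l) (w j) = -1) : 1 ≤ B (w k) (w j) := by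
  have hr := h.exchange_isRoot ha hl hxa hxl hal
  have h1 := h.polar_nonneg k hk j hj hkj
  by_contra h2
  have h3 := h.maximal (x + w a - w l + w k + w j + Pi.single p 1)
    ⟨add_nonneg (add_nonneg (add_nonneg hr.1 (h.unit_nonneg hk)) (h.unit_nonneg hj))
      (single_nonneg' p), by
        rw [h.map_add, h.map_add, h.map_add (x + w a - w l), hr.2]
        simp only [map_add, map_sub, LinearMap.add_apply, LinearMap.sub_apply,
          (h.decomposition.1 k hk).2, (h.decomposition.1 j hj).2, h.unit,
          h.polar_unit_single hk, h.polar_unit_single hj, h.polar_unit_single ha,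
          h.polar_unit_single hl, hp]
        omega⟩ (by simp [hφa, hφl, hφk, hφj, h.functional_single])
  simp [h.coord, h.unit_apply ha, h.unit_apply hl, h.unit_apply hk, h.unit_apply hj] at h3

end Exchange

open CliqueWeights

theorem polar_sum_sum_clique (h : IsExtremalStar q B φ p m x I w) {s : Finset ℕ} (hs : s ⊆ I)
    (hc : IsUnitClique (fun i j => B (w i) (w j)) s) :
    B (∑ i ∈ s, w i) (∑ i ∈ s, w i) = s.card * (s.card + 1) := by
  rw [LinearMap.map_sum₂]
  have h1 : ∀ i ∈ s, B (w i) (∑ j ∈ s, w j) = s.card + 1 := by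
    intro i hi
    rw [map_sum, ← Finset.add_sum_erase _ _ hi, h.polar_unit_unit (hs hi),
      Finset.sum_congr rfl fun j hj => hc i hi j (Finset.mem_of_mem_erase hj)
        (Finset.ne_of_mem_erase hj).symm]
    have := Finset.card_erase_add_one hi
    simp only [Finset.sum_const, mul_one, nsmul_eq_mul]
    push_cast [← this]
    ring
  rw [Finset.sum_congr rfl h1]
  simp

theorem polar_sum_sum_orthogonal {s t : Finset ℕ}
    (ho : Orthogonal (fun i j => B (w i) (w j)) s t) :
    B (∑ i ∈ s, w i) (∑ i ∈ t, w i) = 0 := by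
  rw [LinearMap.map_sum₂]
  refine Finset.sum_eq_zero fun i hi => ?_
  rw [map_sum]
  exact Finset.sum_eq_zero fun j hj => ho i hi j hj

theorem polar_sum_single (h : IsExtremalStar q B φ p m x I w) {s : Finset ℕ} (hs : s ⊆ I) :
    B (∑ i ∈ s, w i) (Pi.single p 1) = -s.card := by
  rw [map_sum, LinearMap.sum_apply, Finset.sum_congr rfl fun i hi => h.polar_unit_single (hs hi)]
  simp

/-- The expression is `2 * q` at `c e_p` plus the clique sums weighted by the `a`'s, a non-zero
vector of the cone killed by `φ`. -/
theorem arms_pos (h : IsExtremalStar q B φ p m x I w) {s₁ s₂ s₃ : Finset ℕ}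
    (hs₁ : s₁ ⊆ I.filter fun i => φ (w i) = 0) (hs₂ : s₂ ⊆ I.filter fun i => φ (w i) = 0)
    (hs₃ : s₃ ⊆ I.filter fun i => φ (w i) = 0)
    (hc₁ : IsUnitClique (fun i j => B (w i) (w j)) s₁)
    (hc₂ : IsUnitClique (fun i j => B (w i) (w j)) s₂)
    (hc₃ : IsUnitClique (fun i j => B (w i) (w j)) s₃)
    (ho₁₂ : Orthogonal (fun i j => B (w i) (w j)) s₁ s₂)
    (ho₁₃ : Orthogonal (fun i j => B (w i) (w j)) s₁ s₃)
    (ho₂₃ : Orthogonal (fun i j => B (w i) (w j)) s₂ s₃) (c a₁ a₂ a₃ : ℕ) (hc : 0 < c) :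
    0 < 2 * (c : ℤ) ^ 2 - 2 * c * (a₁ * s₁.card + a₂ * s₂.card + a₃ * s₃.card)
      + a₁ ^ 2 * (s₁.card * (s₁.card + 1)) + a₂ ^ 2 * (s₂.card * (s₂.card + 1))
      + a₃ ^ 2 * (s₃.card * (s₃.card + 1)) := by
  have hI := Finset.filter_subset (fun i => φ (w i) = 0) I
  have hsub : ∀ s ⊆ I.filter fun i => φ (w i) = 0, 0 ≤ ∑ i ∈ s, w i ∧ φ (∑ i ∈ s, w i) = 0 ∧
      (∑ i ∈ s, w i) p = 0 := by
    intro s hs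
    refine ⟨Finset.sum_nonneg fun i hi => h.unit_nonneg (hI (hs hi)), ?_, ?_⟩
    · rw [map_sum]
      exact Finset.sum_eq_zero fun i hi => (Finset.mem_filter.1 (hs hi)).2
    · rw [Finset.sum_apply]
      exact Finset.sum_eq_zero fun i hi => h.unit_apply (hI (hs hi))
  have hq : ∀ s ⊆ I, IsUnitClique (fun i j => B (w i) (w j)) s →
      2 * q (∑ i ∈ s, w i) = s.card * (s.card + 1) := fun s hs hcs => by
    rw [h.two_mul, h.polar_sum_sum_clique hs hcs]
  have hq₁ := hq s₁ (hs₁.trans hI) hc₁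
  have hq₂ := hq s₂ (hs₂.trans hI) hc₂
  have hq₃ := hq s₃ (hs₃.trans hI) hc₃
  have he₁ := h.polar_sum_single (hs₁.trans hI)
  have he₂ := h.polar_sum_single (hs₂.trans hI)
  have he₃ := h.polar_sum_single (hs₃.trans hI)
  have h₁₂ := polar_sum_sum_orthogonal ho₁₂
  have h₁₃ := polar_sum_sum_orthogonal ho₁₃
  have h₂₃ := polar_sum_sum_orthogonal ho₂₃
  obtain ⟨hn₁, hφ₁, hp₁⟩ := hsub s₁ hs₁
  obtain ⟨hn₂, hφ₂, hp₂⟩ := hsub s₂ hs₂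
  obtain ⟨hn₃, hφ₃, hp₃⟩ := hsub s₃ hs₃
  generalize ∑ i ∈ s₁, w i = k₁ at *
  generalize ∑ i ∈ s₂, w i = k₂ at *
  generalize ∑ i ∈ s₃, w i = k₃ at *
  have hpos := h.pos ((a₁ : ℤ) • k₁ + (a₂ : ℤ) • k₂ + (a₃ : ℤ) • k₃ + (c : ℤ) • Pi.single p 1)
    (add_nonneg (add_nonneg (add_nonneg (smul_nonneg (by positivity) hn₁)
      (smul_nonneg (by positivity) hn₂)) (smul_nonneg (by positivity) hn₃))
      (smul_nonneg (by positivity) (single_nonneg' p)))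
    (by simp only [map_add, map_smul, hφ₁, hφ₂, hφ₃, h.functional_single, smul_zero, add_zero])
    (fun h0 => by
      have := congrFun h0 p
      simp [hp₁, hp₂, hp₃] at this
      omega)
  simp only [h.map_add, map_add, LinearMap.add_apply, h.map_smul, map_smul, LinearMap.smul_apply,
    smul_eq_mul, he₁, he₂, he₃, h₁₂, h₁₃, h₂₃, h.unit] at hpos
  have e₁ : (a₁ : ℤ) ^ 2 * (s₁.card * (s₁.card + 1)) = 2 * (a₁ ^ 2 * q k₁) := by rw [← hq₁]; ring
  have e₂ : (a₂ : ℤ) ^ 2 * (s₂.card * (s₂.card + 1)) = 2 * (a₂ ^ 2 * q k₂) := by rw [← hq₂]; ring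
  have e₃ : (a₃ : ℤ) ^ 2 * (s₃.card * (s₃.card + 1)) = 2 * (a₃ ^ 2 * q k₃) := by rw [← hq₃]; ring
  rw [e₁, e₂, e₃]
  linarith

end IsExtremalStar

end IntForm

end ExtremalStar

/-! ### Coordinate bounds 6 and 12 for roots with `φ = 0` and `φ = 1`. -/

section CoordinateBounds

variable {V : Type*} [Fintype V] [DecidableEq V]

set_option linter.unusedSectionVars false

theorem Finset.sum_union_erase {ι : Type*} [DecidableEq ι] {s t : Finset ι} (hst : Disjoint s t)
    {a : ι} (ha : a ∈ s) (f : ι → ℤ) :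
    ∑ i ∈ (s ∪ t).erase a, f i = ∑ i ∈ s.erase a, f i + ∑ i ∈ t, f i := by
  rw [Finset.erase_union_distrib, Finset.erase_eq_of_notMem (Finset.disjoint_left.1 hst ha),
    Finset.sum_union (hst.mono_left (Finset.erase_subset a s))]

theorem Finset.sum_erase_sub_one {ι : Type*} [DecidableEq ι] {s : Finset ι} {a : ι} (ha : a ∈ s)
    (f : ι → ℤ) : ∑ i ∈ s.erase a, (f i - 1) = ∑ i ∈ s.erase a, f i - s.card + 1 := by
  have := Finset.card_erase_add_one ha
  rw [Finset.sum_sub_distrib]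
  simp only [Finset.sum_const, nsmul_eq_mul, mul_one]
  push_cast [← this]
  ring

namespace IntForm

open CliqueWeights

namespace IsExtremalStar

variable {q : (V → ℤ) → ℤ} {B : LinearMap.BilinForm ℤ (V → ℤ)} {φ : (V → ℤ) →ₗ[ℤ] ℤ} {p : V}
  {m : ℤ} {x : V → ℤ} {I : Finset ℕ} {w : ℕ → V → ℤ}

/-- The units on which `B x` is `-1`. -/
def lowUnits (B : LinearMap.BilinForm ℤ (V → ℤ)) (φ : (V → ℤ) →ₗ[ℤ] ℤ) (x : V → ℤ) (I : Finset ℕ)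
    (w : ℕ → V → ℤ) : Finset ℕ :=
  I.filter fun i => φ (w i) = 0 ∧ B x (w i) = -1

/-- The units on which `B x` vanishes. -/
def flatUnits (B : LinearMap.BilinForm ℤ (V → ℤ)) (φ : (V → ℤ) →ₗ[ℤ] ℤ) (x : V → ℤ) (I : Finset ℕ)
    (w : ℕ → V → ℤ) : Finset ℕ :=
  I.filter fun i => φ (w i) = 0 ∧ B x (w i) = 0

theorem mem_lowUnits {i : ℕ} :
    i ∈ lowUnits B φ x I w ↔ i ∈ I ∧ φ (w i) = 0 ∧ B x (w i) = -1 := Finset.mem_filter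

theorem mem_flatUnits {i : ℕ} :
    i ∈ flatUnits B φ x I w ↔ i ∈ I ∧ φ (w i) = 0 ∧ B x (w i) = 0 := Finset.mem_filter

theorem disjoint_units : Disjoint (lowUnits B φ x I w) (flatUnits B φ x I w) := by
  rw [Finset.disjoint_left]
  intro i hi hi'
  rw [mem_lowUnits] at hi
  rw [mem_flatUnits] at hi'
  omega

theorem units_union (h : IsExtremalStar q B φ p m x I w) :
    lowUnits B φ x I w ∪ flatUnits B φ x I w = I.filter fun i => φ (w i) = 0 := by
  ext i
  simp only [Finset.mem_union, mem_lowUnits, mem_flatUnits, Finset.mem_filter]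
  constructor
  · tauto
  · rintro ⟨hi, hφ⟩
    have := h.polar_root_unit_mem hi hφ
    tauto

theorem sum_polar_units (h : IsExtremalStar q B φ p m x I w) :
    ∑ i ∈ I.filter (fun i => φ (w i) = 0), B x (w i) = -(lowUnits B φ x I w).card := by
  rw [← h.units_union, Finset.sum_union disjoint_units,
    Finset.sum_congr rfl fun i hi => (mem_lowUnits.1 hi).2.2,
    Finset.sum_congr rfl fun i hi => (mem_flatUnits.1 hi).2.2]
  simp

theorem card_units (h : IsExtremalStar q B φ p m x I w) :
    (lowUnits B φ x I w).card + (flatUnits B φ x I w).card =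
      (I.filter fun i => φ (w i) = 0).card := by
  rw [← h.units_union, Finset.card_union_of_disjoint disjoint_units]

theorem isStar (h : IsExtremalStar q B φ p m x I w) (hp : B x (Pi.single p 1) = 1)
    (hne : (flatUnits B φ x I w).Nonempty)
    (hsum : ∀ l ∈ flatUnits B φ x I w,
      ∑ j ∈ (flatUnits B φ x I w).erase l, (B (w l) (w j) - 1) ≤ -2) :
    IsStar (fun i j => B (w i) (w j)) (lowUnits B φ x I w) (flatUnits B φ x I w) where
  symm _ _ := h.symm _ _
  disj := disjoint_units
  nonneg i hi j hj hij := by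
    rw [h.units_union] at hi hj
    exact h.polar_nonneg i (Finset.mem_filter.1 hi).1 j (Finset.mem_filter.1 hj).1 hij
  nonempty := hne
  clique i hi j hj hij := by
    rw [mem_lowUnits] at hi hj
    exact h.one_le_polar hp hi.1 hj.1 hij hi.2.1 hj.2.1 hi.2.2 hj.2.2
  indep i hi j hj k hk hij hik hjk := by
    rw [mem_flatUnits] at hi hj hk
    exact h.not_independent hp hi.1 hj.1 hk.1 hij hik hjk hi.2.1 hj.2.1 hk.2.1
      hi.2.2 hj.2.2 hk.2.2
  sum_le := hsum
  arms s₁ hs₁ s₂ hs₂ s₃ hs₃ hc₁ hc₂ hc₃ ho₁₂ ho₁₃ ho₂₃ := by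
    rw [h.units_union] at hs₁ hs₂ hs₃
    exact h.arms_pos hs₁ hs₂ hs₃ hc₁ hc₂ hc₃ ho₁₂ ho₁₃ ho₂₃

theorem sum_functional (h : IsExtremalStar q B φ p m x I w) : ∑ i ∈ I, φ (w i) = φ x := by
  have h1 := congrArg φ h.eq_add_sum
  rw [map_add, map_smul, h.functional_single, map_sum, smul_zero, zero_add] at h1
  exact h1.symm

end IsExtremalStar

namespace IsConeForm

variable {q : (V → ℤ) → ℤ} {B : LinearMap.BilinForm ℤ (V → ℤ)} {φ : (V → ℤ) →ₗ[ℤ] ℤ}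

open IsExtremalStar

theorem functional_single_nonneg (h : IsConeForm q B φ) (i : V) : 0 ≤ φ (Pi.single i 1) :=
  h.functional_nonneg _ (single_nonneg' i)

theorem functional_mono (h : IsConeForm q B φ) {y z : V → ℤ} (hyz : y ≤ z) : φ y ≤ φ z := by
  have := h.functional_nonneg _ (sub_nonneg.2 hyz)
  rw [map_sub] at this
  omega

/-- **Ovsienko's theorem**: the coordinates of a positive root in the region where the form is
positive are at most `6`. -/
theorem root_le_six (h : IsConeForm q B φ) {x : V → ℤ} (hx : IsRoot q x) (hφ : φ x = 0) (p : V) :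
    x p ≤ 6 := by
  by_contra hcon
  push Not at hcon
  have hφp : φ (Pi.single p 1) = 0 := by
    have h1 := h.functional_single_nonneg p
    have h2 := h.functional_mono (Pi.single_one_le hx.1 (i := p) (by omega))
    omega
  have hbox : ∀ x, IsRoot q x → φ x = 0 → ∀ z, 0 ≤ z → z ≤ x → z ≠ 0 → 1 ≤ q z := by
    intro x _ hφx z hz hzx hz0
    refine h.pos z hz ?_ hz0
    have h1 := h.functional_nonneg z hz
    have h2 := h.functional_mono hzx
    omega
  -- There will be `2m - 1` units: `m - 2 ≥ 5` low ones, enough for the long arm of type E8, and `m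
  -- + 1` flat ones.
  obtain ⟨m, y, I, w, hm, hφy, hs⟩ := h.exists_isExtremalStar (N := 7) (by norm_num) hx hcon hφp
    (fun y hy hφy hyp => h.pos y hy (hφy.trans hφ) fun h0 => by
      rw [h0, Pi.zero_apply] at hyp; omega)
    (fun y hy hφy _ => hbox y hy (hφy.trans hφ))
  rw [hφ] at hφy
  have hfil : I.filter (fun i => φ (w i) = 0) = I := by
    refine Finset.filter_true_of_mem ?_
    exact (Finset.sum_eq_zero_iff_of_nonneg fun i hi => hs.functional_unit hi).1
      (hs.sum_functional.trans hφy)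
  have hsum := hs.sum_polar
  have hA := hs.sum_polar_units
  have hcard := hs.card_units
  have hunion := hs.units_union
  rw [hfil] at hA hcard hunion
  have hp1 : B y (Pi.single p 1) = 1 := by
    have h1 := hs.polar_root_single_mem
    by_contra h2
    have h3 : B y (Pi.single p 1) = 0 := by omega
    rw [h3] at hsum
    omega
  have hI := hs.polar_root_single
  rw [hp1] at hsum hI
  have hdeg : ∀ i ∈ I, ∑ j ∈ I.erase i, B (w i) (w j) = B y (w i) + m - 2 := fun i hi =>
    hs.degree_eq hi
  have hAB := disjoint_units (B := B) (φ := φ) (x := y) (I := I) (w := w)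
  have hst := hs.isStar hp1 (by rw [← Finset.card_pos]; omega) (by
    intro l hl
    have hl' := mem_flatUnits.1 hl
    have h1 := hdeg l hl'.1
    rw [← hunion, Finset.union_comm, Finset.sum_union_erase hAB.symm hl, hl'.2.2] at h1
    have h2 : 0 ≤ ∑ j ∈ lowUnits B φ y I w, B (w l) (w j) := Finset.sum_nonneg fun j hj =>
      hs.polar_nonneg l hl'.1 j (mem_lowUnits.1 hj).1 fun e =>
        Finset.disjoint_left.1 hAB hj (e ▸ hl)
    rw [Finset.sum_erase_sub_one hl]
    omega)
  refine hst.false_of_exact (by omega) fun a ha => ?_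
  have ha' := mem_lowUnits.1 ha
  have h1 := hdeg a ha'.1
  rw [← hunion, Finset.sum_union_erase hAB ha, ha'.2.2] at h1
  rw [Finset.sum_erase_sub_one ha]
  omega

/-- Removing an `e_j` with `φ e_j = 1` leaves a root with `φ = 0` and the same `p`-coordinate,
because `y` is orthogonal to `e_j`. -/
theorem isotropic_le_six (h : IsConeForm q B φ) {y : V → ℤ} (hy : 0 ≤ y) (hq : q y = 0)
    (hφ : φ y = 1) {p : V} (hp : φ (Pi.single p 1) = 0) : y p ≤ 6 := by
  obtain ⟨j, hj⟩ : ∃ j, 0 < y j * φ (Pi.single j 1) := by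
    by_contra hcon
    push Not at hcon
    have h1 := Finset.sum_nonpos fun j (_ : j ∈ Finset.univ) => hcon j
    rw [← φ.apply_eq_sum_single] at h1
    omega
  have hφj : φ (Pi.single j 1) ≠ 0 := fun h0 => by simp [h0] at hj
  have hyj : 0 < y j := lt_of_le_of_ne (hy j) fun h0 => by
    rw [← h0] at hj
    simp at hj
  have hle := Pi.single_one_le hy hyj
  have h1 := h.functional_mono hle
  have h2 := h.functional_single_nonneg j
  have h3 := h.isotropic_eq_zero h.weaklyNonneg hy hq (single_nonneg' j) hle
  have h4 := h.root_le_six (x := y - Pi.single j 1) ⟨sub_nonneg.2 hle, by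
    rw [h.map_sub, hq, h.unit, h3]; rfl⟩ (by rw [map_sub]; omega) p
  have hpj : p ≠ j := fun e => hφj (e ▸ hp)
  simpa [hpj] using h4

/-- Roots with non-negative mutual products number at most `q u`, so `u` is a sum of at most two
roots. -/
theorem le_twelve_of_le_two (h : IsConeForm q B φ) {u : V → ℤ} (hu : 0 ≤ u) (hφ : φ u = 0)
    (hq : q u ≤ 2) (p : V) : u p ≤ 12 := by
  have hbox : ∀ z, 0 ≤ z → z ≤ u → φ z = 0 := fun z hz hzu => by
    have h1 := h.functional_nonneg z hz
    have h2 := h.functional_mono hzu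
    omega
  obtain ⟨I, w, hIw, hnn⟩ := h.exists_rootDecomposition_nonneg hu
    fun z hz hzu => h.pos z hz (hbox z hz hzu)
  have h1 : 2 * (I.card : ℤ) ≤ 2 * q u := by
    rw [h.two_mul]
    nth_rw 1 [← hIw.2]
    rw [LinearMap.map_sum₂, mul_comm, ← nsmul_eq_mul]
    refine Finset.card_nsmul_le_sum _ _ _ fun i hi => ?_
    rw [← hIw.2, map_sum, ← Finset.add_sum_erase _ _ hi, ← h.two_mul, (hIw.1 i hi).2]
    have := Finset.sum_nonneg fun j (hj : j ∈ I.erase i) =>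
      hnn i hi j (Finset.mem_of_mem_erase hj) (Finset.ne_of_mem_erase hj).symm
    omega
  have h2 : u p ≤ I.card * 6 := by
    rw [← hIw.2, Finset.sum_apply, ← nsmul_eq_mul]
    refine Finset.sum_le_card_nsmul _ _ _ fun i hi => h.root_le_six (hIw.1 i hi) ?_ p
    exact hbox _ (hIw.1 i hi).1 (by
      have := hIw.le (Finset.singleton_subset_iff.2 hi)
      rwa [Finset.sum_singleton] at this)
  omega

theorem root_le_twelve (h : IsConeForm q B φ) {x : V → ℤ} (hx : IsRoot q x) (hφ : φ x = 1) {p : V}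
    (hφp : φ (Pi.single p 1) = 0) : x p ≤ 12 := by
  by_contra hcon
  push Not at hcon
  -- An isotropic `z ≤ x` has `φ z = 1`, so `x - z` is zero or a root with `φ = 0`; both parts have
  -- `p`-coordinate at most `6`.
  have hbox : ∀ x, IsRoot q x → φ x = 1 → 13 ≤ x p → ∀ z, 0 ≤ z → z ≤ x → z ≠ 0 → 1 ≤ q z := by
    intro x hx hφx hxp z hz hzx hz0
    by_contra hqz
    have hqz0 : q z = 0 := by
      have := h.weaklyNonneg z hz
      omega
    have h1 := h.functional_nonneg z hz
    have h2 := h.functional_mono hzx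
    have hφz : φ z = 1 := by
      by_contra h3
      exact hqz (h.pos z hz (by omega) hz0)
    have h3 := h.isotropic_le_six hz hqz0 hφz hφp
    have h4 := h.isotropic_nonneg h.weaklyNonneg hz hqz0 hx.1
    have h5 : q (x - z) ≤ 1 := by
      rw [h.map_sub, hx.2, hqz0, h.symm]
      omega
    have h6 : (x - z) p ≤ 6 := by
      by_cases h7 : x - z = 0
      · rw [h7]
        norm_num
      · have hφ0 : φ (x - z) = 0 := by rw [map_sub]; omega
        have h8 := h.pos _ (sub_nonneg.2 hzx) hφ0 h7
        exact h.root_le_six ⟨sub_nonneg.2 hzx, by omega⟩ hφ0 p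
    rw [Pi.sub_apply] at h6
    omega
  obtain ⟨m, y, I, w, hm, hφy, hs⟩ := h.exists_isExtremalStar (N := 13) (by norm_num) hx hcon hφp
    (fun y hy hφy hyp => by
      by_contra hqy
      have h0 := h.weaklyNonneg y hy
      have := h.isotropic_le_six hy (by omega) (hφy.trans hφ) hφp
      omega)
    (fun y hy hφy => hbox y hy (hφy.trans hφ))
  rw [hφ] at hφy
  have hsumφ := hs.sum_functional
  rw [hφy] at hsumφ
  obtain ⟨b, hb, hφb⟩ : ∃ b ∈ I, φ (w b) ≠ 0 := by
    by_contra h0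
    push Not at h0
    rw [Finset.sum_eq_zero h0] at hsumφ
    omega
  rw [← Finset.add_sum_erase I _ hb] at hsumφ
  have hnnφ : ∀ i ∈ I.erase b, 0 ≤ φ (w i) := fun i hi =>
    hs.functional_unit (Finset.mem_of_mem_erase hi)
  have hφb1 : φ (w b) = 1 := by
    have h1 := hs.functional_unit hb
    have h2 := Finset.sum_nonneg hnnφ
    omega
  have hfil : I.filter (fun i => φ (w i) = 0) = I.erase b := by
    have h1 := (Finset.sum_eq_zero_iff_of_nonneg hnnφ).1 (by omega)
    ext i
    rw [Finset.mem_filter, Finset.mem_erase]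
    constructor
    · rintro ⟨hi, hi0⟩
      exact ⟨fun e => hφb (e ▸ hi0), hi⟩
    · rintro ⟨hib, hi⟩
      exact ⟨hi, h1 i (Finset.mem_erase.2 ⟨hib, hi⟩)⟩
  have hb0 := hs.unit_nonneg hb
  have hqb := (hs.decomposition.1 b hb).2
  -- Otherwise `y - w b` has `φ = 0` and value at most `2`, but `p`-coordinate `m ≥ 13`.
  have hupper : B y (w b) ≤ -1 := by
    by_contra h0
    have h1 := h.le_twelve_of_le_two (sub_nonneg.2 (hs.unit_le hb))
      (by rw [map_sub]; omega) (by rw [h.map_sub, hs.root.2, hqb]; omega) p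
    rw [Pi.sub_apply, hs.coord, hs.unit_apply hb] at h1
    omega
  have hadd : q (y + w b) = 2 + B y (w b) := by
    rw [h.map_add, hs.root.2, hqb]
    rfl
  have hlower : -2 ≤ B y (w b) := by
    have := h.weaklyNonneg _ (add_nonneg hs.root.1 hb0)
    omega
  have hsum := hs.sum_polar
  have hA := hs.sum_polar_units
  have hcard := hs.card_units
  have hunion := hs.units_union
  rw [hfil] at hA hcard hunion
  rw [← Finset.add_sum_erase I _ hb, hA] at hsum
  have hcardI := Finset.card_erase_add_one hb
  have hp1 : B y (Pi.single p 1) = 1 := by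
    have h1 := hs.polar_root_single_mem
    by_contra h2
    have h3 : B y (Pi.single p 1) = 0 := by omega
    rw [h3] at hsum
    omega
  have hI := hs.polar_root_single
  rw [hp1] at hsum hI
  have hdeg : ∀ i ∈ I.erase b, B (w i) (w b) + ∑ j ∈ (I.erase b).erase i, B (w i) (w j) =
      B y (w i) + m - 2 := fun i hi => by
    have hi' := Finset.mem_erase.1 hi
    rw [Finset.erase_right_comm, Finset.add_sum_erase (I.erase i) (fun j => B (w i) (w j))
      (Finset.mem_erase.2 ⟨Ne.symm hi'.1, hb⟩)]
    exact hs.degree_eq hi'.2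
  have hQb : ∀ i ∈ I.erase b, 0 ≤ B (w i) (w b) := fun i hi =>
    hs.polar_nonneg i (Finset.mem_erase.1 hi).2 b hb (Finset.mem_erase.1 hi).1
  have hAB := disjoint_units (B := B) (φ := φ) (x := y) (I := I) (w := w)
  have hst := hs.isStar hp1 (by rw [← Finset.card_pos]; omega) (by
    intro l hl
    have hl' := mem_flatUnits.1 hl
    have hlb : l ∈ I.erase b := hunion ▸ Finset.mem_union_right _ hl
    have h1 := hdeg l hlb
    rw [← hunion, Finset.union_comm, Finset.sum_union_erase hAB.symm hl, hl'.2.2] at h1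
    have h2 : 0 ≤ ∑ j ∈ lowUnits B φ y I w, B (w l) (w j) := Finset.sum_nonneg fun j hj =>
      hs.polar_nonneg l hl'.1 j (mem_lowUnits.1 hj).1 fun e =>
        Finset.disjoint_left.1 hAB hj (e ▸ hl)
    have h3 := hQb l hlb
    rw [Finset.sum_erase_sub_one hl]
    omega)
  -- The number of low units is `m - 2 + B y (w b) ≥ m - 4 ≥ 9`.
  refine hst.false_of_excess_le_one (by omega) (fun a ha => ?_) (fun a ha l hl hal k hk hkl => ?_)
    (fun a ha l hl hal k hk k' hk' hkl hkl' hkk' h1 h2 => ?_)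
    (fun a ha l hl hal k hk a' ha' hkl haa' h1 h2 => ?_)
  · have ha' := mem_lowUnits.1 ha
    have hab : a ∈ I.erase b := hunion ▸ Finset.mem_union_left _ ha
    have h1 := hdeg a hab
    rw [← hunion, Finset.sum_union_erase hAB ha, ha'.2.2] at h1
    rw [Finset.sum_erase_sub_one ha]
    have h2 := hQb a hab
    -- The excess at `a` is `-B y (w b) - B (w a) (w b)`. When `B y (w b) = -2`, the vector `y + w
    -- b` is isotropic, which forces `B (w a) (w b) ≥ 1`.
    rcases (by omega : B y (w b) = -1 ∨ B y (w b) = -2) with h3 | h3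
    · omega
    · have h4 := h.isotropic_nonneg h.weaklyNonneg (add_nonneg hs.root.1 hb0) (by omega)
        (hs.unit_nonneg ha'.1)
      rw [map_add, LinearMap.add_apply, ha'.2.2, h.symm (w b)] at h4
      omega
  · rw [mem_lowUnits] at ha
    rw [mem_flatUnits] at hl hk
    have := (hs.exchange_polar_mem hp1 ha.1 hl.1 ha.2.1 hl.2.1 ha.2.2 hl.2.2 hal hk.1 hkl
      hk.2.1).1
    omega
  · rw [mem_lowUnits] at ha
    rw [mem_flatUnits] at hl hk hk'
    exact hs.exchange_one_le_polar hp1 ha.1 hl.1 ha.2.1 hl.2.1 ha.2.2 hl.2.2 hal hk.1 hk'.1 hkk'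
      hk.2.1 hk'.2.1 (by omega) (by omega)
  · have hne : k ≠ a' := fun e => Finset.disjoint_left.1 hAB ha' (e ▸ hk)
    rw [mem_lowUnits] at ha ha'
    rw [mem_flatUnits] at hl hk
    exact hs.exchange_one_le_polar hp1 ha.1 hl.1 ha.2.1 hl.2.1 ha.2.2 hl.2.2 hal hk.1 ha'.1 hne
      hk.2.1 ha'.2.1 (by omega) (by omega)

end IsConeForm

end IntForm

end CoordinateBounds

/-! ### Maximal roots: weak non-negativity and the bound 12. -/

section MaximalRoots

variable {V : Type*} [Fintype V] [DecidableEq V]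

set_option linter.unusedSectionVars false

namespace IntForm

variable {q : (V → ℤ) → ℤ} {B : LinearMap.BilinForm ℤ (V → ℤ)} {v : V → ℤ}

theorem IsUnitForm.polar_eq (h : IsUnitForm q B) (x y : V → ℤ) : QuadraticMap.polar q x y = B x y := by
  rw [QuadraticMap.polar, h.map_add]
  ring

/-- A maximal root pairs non-negatively with the canonical basis. -/
theorem IsMaximalRoot.polar_single_nonneg (h : IsUnitForm q B) (hv : IsMaximalRoot q v) (i : V) :
    0 ≤ B v (Pi.single i 1) := by
  -- Reflecting `v` at `e_i` would give a strictly larger root.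
  by_contra hneg
  push Not at hneg
  have h1 : (0 : V → ℤ) ≤ -B v (Pi.single i 1) • Pi.single i 1 :=
    smul_nonneg (by omega) (Pi.single_nonneg.2 zero_le_one)
  have h2 := hv.2 (v + -B v (Pi.single i 1) • Pi.single i 1) ⟨add_nonneg hv.1.1 h1, by
    rw [h.map_add, h.map_smul, h.unit, map_smul, hv.1.2, smul_eq_mul]
    ring⟩ (le_add_of_nonneg_right h1)
  have h3 := congrFun (add_eq_left.1 h2) i
  simp at h3
  omega

theorem IsMaximalRoot.polar_nonneg (h : IsUnitForm q B) (hv : IsMaximalRoot q v) {y : V → ℤ}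
    (hy : 0 ≤ y) : 0 ≤ B v y :=
  LinearMap.apply_nonneg_of_single (f := B v) (hv.polar_single_nonneg h) hy

theorem IsMaximalRoot.polar_isotropic_pos (h : IsUnitForm q B) (hv : IsMaximalRoot q v) {y : V → ℤ}
    (hy : 0 ≤ y) (hq : q y = 0) (hy0 : y ≠ 0) : 0 < B v y := by
  refine lt_of_le_of_ne (hv.polar_nonneg h hy) fun h0 => hy0 ?_
  have h1 := hv.2 (v + y) ⟨add_nonneg hv.1.1 hy, by rw [h.map_add, hv.1.2, hq, ← h0]; rfl⟩
    (le_add_of_nonneg_right hy)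
  exact add_eq_left.1 h1

/-- The left side is `2 y i` minus the sum of the other coordinates. -/
theorem IsUnitForm.polar_ge_of_isSlender (h : IsUnitForm q B) (hs : IsSlender q) {y : V → ℤ}
    (hy : 0 ≤ y) (i : V) : 3 * y i - ∑ j, y j ≤ B y (Pi.single i 1) := by
  have h1 : ∑ j ∈ Finset.univ.erase i, -y j ≤
      ∑ j ∈ Finset.univ.erase i, y j * B (Pi.single i 1) (Pi.single j 1) := by
    refine Finset.sum_le_sum fun j hj => ?_
    have h2 := hs i j (Finset.ne_of_mem_erase hj).symm
    rw [h.polar_eq] at h2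
    have h3 := hy j
    simp only [Pi.zero_apply] at h3
    nlinarith
  have h2 := h.two_mul (Pi.single i 1)
  rw [h.unit] at h2
  have h3 := Finset.add_sum_erase Finset.univ y (Finset.mem_univ i)
  have h4 := Finset.add_sum_erase Finset.univ
    (fun j => y j * B (Pi.single i 1) (Pi.single j 1)) (Finset.mem_univ i)
  rw [h.symm, (B (Pi.single i 1)).apply_eq_sum_single y, ← h3, ← h4]
  simp only [← h2]
  rw [Finset.sum_neg_distrib] at h1
  linarith

theorem IsMaximalRoot.isWeaklyNonneg (h : IsUnitForm q B) (hs : IsSlender q)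
    (hv : IsMaximalRoot q v) (hv' : IsOmnipresent v) : IsWeaklyNonneg q := by
  classical
  by_contra hcon
  have hex : ∃ n : ℕ, ∃ y : V → ℤ, 0 ≤ y ∧ q y < 0 ∧ ∑ i, y i = n := by
    unfold IsWeaklyNonneg at hcon
    push Not at hcon
    obtain ⟨y, hy, hqy⟩ := hcon
    exact ⟨(∑ i, y i).toNat, y, hy, hqy,
      (Int.toNat_of_nonneg (Finset.sum_nonneg fun i _ => hy i)).symm⟩
  obtain ⟨y, hy, hqy, hsum⟩ := Nat.find_spec hex
  have hmin : ∀ i, 0 < y i → 0 ≤ q (y - Pi.single i 1) := by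
    intro i hi
    by_contra h1
    have h2 : ∑ j, (y - Pi.single i 1 : V → ℤ) j = ∑ j, y j - 1 := by
      simp [Finset.sum_sub_distrib]
    have h3 : y i ≤ ∑ j, y j := Finset.single_le_sum (fun j _ => hy j) (Finset.mem_univ i)
    exact Nat.find_min hex (m := Nat.find hex - 1) (by omega)
      ⟨y - Pi.single i 1, sub_nonneg.2 (Pi.single_one_le hy hi), by omega, by omega⟩
  have hsub : ∀ i, q (y - Pi.single i 1) = q y + 1 - B y (Pi.single i 1) := fun i => by
    rw [h.map_sub, h.unit]
  have hle : ∀ i, 0 < y i → B y (Pi.single i 1) ≤ q y + 1 := fun i hi => by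
    have := hmin i hi
    rw [hsub] at this
    omega
  have hpol : 2 * q y = ∑ i, y i * B y (Pi.single i 1) := by
    rw [h.two_mul, (B y).apply_eq_sum_single]
  have hslender := h.polar_ge_of_isSlender hs hy
  have hy0 : y ≠ 0 := fun h0 => by
    rw [h0, h.map_zero] at hqy
    omega
  obtain ⟨i₀, hi₀⟩ : ∃ i, 0 < y i := by
    by_contra h0
    push Not at h0
    exact hy0 (le_antisymm h0 hy)
  -- vectors `y - e_i` which are isotropic pair positively with `v`
  have hiso : ∀ i, 0 < y i → B y (Pi.single i 1) = q y + 1 → B v (Pi.single i 1) < B v y := by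
    intro i hi hB
    have h1 := hv.polar_isotropic_pos h (sub_nonneg.2 (Pi.single_one_le hy hi))
      (by rw [hsub]; omega) (fun h0 => by
        rw [sub_eq_zero.1 h0, h.unit] at hqy
        omega)
    rw [map_sub] at h1
    omega
  have hvy := hv.polar_nonneg h hy
  have hbound : ∀ c : ℤ, (∀ i, 0 < y i → B y (Pi.single i 1) ≤ c) → 2 * q y ≤ (∑ i, y i) * c := by
    intro c hc
    rw [hpol, Finset.sum_mul]
    refine Finset.sum_le_sum fun i _ => ?_
    rcases (hy i).eq_or_lt with h0 | h0
    · rw [Pi.zero_apply] at h0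
      rw [← h0]
      simp
    · exact mul_le_mul_of_nonneg_left (hc i h0) h0.le
  have hvne : v + B v y • y ≠ v ∨ B v y = 0 := by
    by_cases h0 : B v y = 0
    · exact Or.inr h0
    · exact Or.inl fun h1 => by
        have := add_eq_left.1 h1
        rcases smul_eq_zero.1 this with h2 | h2
        · exact h0 h2
        · exact hy0 h2
  rcases (by omega : q y = -1 ∨ q y ≤ -2) with hq1 | hq2
  -- With `q y = -1`, the vector `v + B v y • y` has value `1`, hence equals `v`. No `y - e_i` can
  -- then be isotropic, so the coordinate sum is at most `2` by `hbound` and at least `4` by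
  -- slenderness.
  · have ht : B v y = 0 := by
      refine hvne.resolve_left fun h0 => h0 (hv.2 _ ⟨add_nonneg hv.1.1 (smul_nonneg hvy hy), ?_⟩
        (le_add_of_nonneg_right (smul_nonneg hvy hy)))
      rw [h.map_add, h.map_smul, map_smul, hv.1.2, hq1, smul_eq_mul]
      ring
    have hlt : ∀ i, 0 < y i → B y (Pi.single i 1) ≤ -1 := fun i hi => by
      have h1 := hle i hi
      have h2 := hv.polar_single_nonneg h i
      by_contra h3
      have := hiso i hi (by omega)
      omega
    have h1 := hbound (-1) hlt
    have h2 := hslender i₀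
    have h3 := hlt i₀ hi₀
    omega
  · have h1 := hbound (q y + 1) hle
    have h2 := hslender i₀
    have h3 := hle i₀ hi₀
    generalize hs : ∑ i, y i = s at *
    -- The two estimates combine to `2 q ≤ (2 - q)(q + 1)`, that is, `(q + 2)(q - 1) ≤ 0`.
    have hq : q y = -2 := by
      have h4 := mul_le_mul_of_nonpos_right (by omega : 2 - q y ≤ s) (by omega : q y + 1 ≤ 0)
      have h5 : (2 - q y) * (q y + 1) = q y - q y * q y + 2 := by ring
      by_contra hne
      have h6 : q y ≤ -3 := by omega
      nlinarith
    have hs4 : s = 4 := by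
      rw [hq] at h1 h3
      omega
    have hB : ∀ i, 0 < y i → B y (Pi.single i 1) ≤ -1 := fun i hi => by
      have := hle i hi
      omega
    have hy1 : ∀ i, y i ≤ 1 := fun i => by
      by_contra h4
      have h5 := hslender i
      have h6 := hB i (by omega)
      omega
    have hBeq : ∀ i, 0 < y i → B y (Pi.single i 1) = q y + 1 := by
      intro i hi
      have h4 := hB i hi
      have h5 := hslender i
      omega
    have hlt : ∀ i, 0 < y i → B v (Pi.single i 1) < B v y := fun i hi => hiso i hi (hBeq i hi)
    -- Here `y` has coordinates `0` and `1`, so omnipresence gives `y ≤ v`. Once `0` and `1` are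
    -- excluded, `B v y = 2` and `v + y` is a root.
    have hle2 : B v y ≤ 2 := by
      have h4 := h.two_mul v
      have h5 := hv.polar_nonneg h (y := v - y) (sub_nonneg.2 fun i => (hy1 i).trans (hv' i))
      rw [map_sub] at h5
      have := hv.1.2
      omega
    have hne1 : B v y ≠ 1 := by
      intro h4
      have h5 : ∑ i, y i * B v (Pi.single i 1) ≤ 0 := by
        refine Finset.sum_nonpos fun i _ => ?_
        rcases (hy i).eq_or_lt with h0 | h0
        · rw [Pi.zero_apply] at h0
          rw [← h0]
          simp
        · have h6 := hlt i h0
          have h7 := hv.polar_single_nonneg h i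
          rw [(by omega : B v (Pi.single i 1) = 0), mul_zero]
      rw [← (B v).apply_eq_sum_single] at h5
      omega
    have h4 := hlt i₀ hi₀
    have h5 := hv.polar_single_nonneg h i₀
    have h6 := hv.2 (v + y) ⟨add_nonneg hv.1.1 hy, by
      rw [h.map_add, hv.1.2]
      omega⟩ (le_add_of_nonneg_right hy)
    exact hy0 (add_eq_left.1 h6)

theorem IsMaximalRoot.isConeForm (h : IsUnitForm q B) (hq : IsWeaklyNonneg q)
    (hv : IsMaximalRoot q v) : IsConeForm q B (B v) :=
  { h with
    weaklyNonneg := hq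
    functional_nonneg := fun _ hy => hv.polar_nonneg h hy
    pos := fun y hy hφ hy0 => by
      have h1 := hq y hy
      by_contra h2
      have := hv.polar_isotropic_pos h hy (by omega) hy0
      omega }

theorem IsMaximalRoot.le_twelve (h : IsUnitForm q B) (hq : IsWeaklyNonneg q)
    (hv : IsMaximalRoot q v) (hv' : IsOmnipresent v) (p : V) : v p ≤ 12 := by
  have hcone := hv.isConeForm h hq
  have hvv : B v v = 2 := by
    have h1 := h.two_mul v
    have h2 := hv.1.2
    omega
  have hterm : ∀ i, v i * B v (Pi.single i 1) ≤ 2 := fun i => by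
    rw [← hvv, (B v).apply_eq_sum_single v]
    exact Finset.single_le_sum (f := fun i => v i * B v (Pi.single i 1))
      (fun j _ => mul_nonneg (hv.1.1 j) (hv.polar_single_nonneg h j)) (Finset.mem_univ i)
  by_cases hp : B v (Pi.single p 1) = 0
  · obtain ⟨a, ha⟩ : ∃ a, B v (Pi.single a 1) ≠ 0 := by
      by_contra h0
      push Not at h0
      rw [(B v).apply_eq_sum_single v, Finset.sum_eq_zero fun i _ => by rw [h0, mul_zero]] at hvv
      omega
    have hpa : p ≠ a := fun e => ha (e ▸ hp)
    have h1 := hv.polar_single_nonneg h a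
    have h2 := hterm a
    have h3 := hv' a
    have hle := Pi.single_one_le hv.1.1 h3
    have h4 : B v (Pi.single a 1) ≤ 2 := by nlinarith
    rcases (by omega : B v (Pi.single a 1) = 1 ∨ B v (Pi.single a 1) = 2) with h5 | h5
    · have h6 := hcone.root_le_twelve (x := v - Pi.single a 1)
        ⟨sub_nonneg.2 hle, by rw [h.map_sub, hv.1.2, h.unit, h5]; rfl⟩
        (by rw [map_sub, hvv, h5]; rfl) hp
      simpa [hpa] using h6
    · have h6 := hcone.le_twelve_of_le_two (sub_nonneg.2 hle) (by rw [map_sub, hvv, h5]; rfl)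
        (by rw [h.map_sub, hv.1.2, h.unit, h5]; norm_num) p
      simpa [hpa] using h6
  · have h1 := hv.polar_single_nonneg h p
    have h2 := hterm p
    have h3 := hv' p
    have h4 : 1 ≤ B v (Pi.single p 1) := by omega
    nlinarith

end IntForm

end MaximalRoots

/-! ### The Tits form of a triangular algebra is a unit form. -/

section TitsForm

namespace PathAlgebra

variable {k V : Type*} [Field k] [Quiver V]

theorem repr_between {i j : V} {x : PathAlgebra k V} (hx : x ∈ between k i j) {p : AllPaths V}
    (hp : (pathBasis k V).repr x p ≠ 0) : p.1 = i ∧ p.2.1 = j := by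
  classical
  by_contra hcon
  refine hp ?_
  refine Submodule.span_induction (p := fun x _ => (pathBasis k V).repr x p = 0) ?_ (by simp)
    (fun x y _ _ hx hy => by simp [hx, hy]) (fun c x _ hx => by simp [hx]) hx
  rintro _ ⟨r, rfl⟩
  rw [ofPath, Module.Basis.repr_self, Finsupp.single_apply, if_neg]
  rintro rfl
  exact hcon ⟨rfl, rfl⟩

theorem repr_arrowPower {m : ℕ} {x : PathAlgebra k V} (hx : x ∈ arrowPower k V m) {p : AllPaths V}
    (hp : (pathBasis k V).repr x p ≠ 0) : m ≤ p.2.2.length := by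
  classical
  by_contra hcon
  refine hp ?_
  refine Submodule.span_induction (p := fun x _ => (pathBasis k V).repr x p = 0) ?_ (by simp)
    (fun x y _ _ hx hy => by simp [hx, hy]) (fun c x _ hx => by simp [hx]) hx
  rintro _ ⟨r, hr, rfl⟩
  rw [ofPath, Module.Basis.repr_self, Finsupp.single_apply, if_neg]
  rintro rfl
  exact hcon hr

end PathAlgebra

namespace BoundQuiver

set_option linter.unusedSectionVars false

variable {k V : Type*} [Field k] [Fintype V] [Quiver V]

theorem zero_notMem_of_isMinimalRelations {I : TwoSidedIdeal (PathAlgebra k V)}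
    {R : Set (PathAlgebra k V)} (hR : IsMinimalRelations I R) : (0 : PathAlgebra k V) ∉ R := by
  intro h0
  have h1 : TwoSidedIdeal.span (R \ {0}) = I := by
    refine le_antisymm ?_ ?_
    · rw [← hR.span_eq]
      exact TwoSidedIdeal.span_mono Set.sdiff_subset
    · rw [← hR.span_eq, TwoSidedIdeal.span_le]
      intro x hx
      by_cases hx0 : x = 0
      · rw [hx0]
        exact TwoSidedIdeal.zero_mem _
      · exact TwoSidedIdeal.subset_span ⟨hx, hx0⟩
  have h2 := hR.minimal _ Set.sdiff_subset h1
  rw [← h2] at h0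
  exact h0.2 rfl

/-- Such a relation would combine closed paths of length at least two, so it would be zero, which a
minimal generating set omits. -/
theorem relationCount_self (hQ : Quiver.NoOrientedCycles V) {I : TwoSidedIdeal (PathAlgebra k V)}
    (hI : IsAdmissible I) {R : Set (PathAlgebra k V)} (hR : IsMinimalRelations I R) (i : V) :
    relationCount I R i i = 0 := by
  have h1 : R ∩ idealBetween I i i = ∅ := by
    ext x
    simp only [Set.mem_inter_iff, Set.mem_empty_iff_false, iff_false]
    rintro ⟨hxR, hxI, hxb⟩
    have h0 : x = 0 := by
      refine (PathAlgebra.pathBasis k V).repr.map_eq_zero_iff.1 ?_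
      ext p
      by_contra hp
      rw [Finsupp.coe_zero, Pi.zero_apply] at hp
      have h2 := PathAlgebra.repr_between hxb hp
      have h3 := PathAlgebra.repr_arrowPower (hI.2 x hxI) hp
      obtain ⟨a, b, p⟩ := p
      obtain ⟨h2, h2'⟩ := h2
      simp only at h2 h2'
      subst h2 h2'
      have h4 := hQ _ p
      simp only at h3
      omega
    exact zero_notMem_of_isMinimalRelations hR (h0 ▸ hxR)
  rw [relationCount, h1, Set.ncard_empty]

variable [∀ i j : V, Fintype (i ⟶ j)]

theorem card_hom_self (hQ : Quiver.NoOrientedCycles V) (i : V) : Fintype.card (i ⟶ i) = 0 := by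
  rw [Fintype.card_eq_zero_iff]
  exact ⟨fun a => by simpa using hQ i a.toPath⟩

variable [DecidableEq V]

/-- The polar form of the Tits form. -/
noncomputable def titsPolar (I : TwoSidedIdeal (PathAlgebra k V)) (R : Set (PathAlgebra k V)) :
    LinearMap.BilinForm ℤ (V → ℤ) :=
  Matrix.toBilin' (Matrix.of fun i j => (if i = j then 2 else 0) +
    ((relationCount I R i j : ℤ) - Fintype.card (i ⟶ j)) +
    ((relationCount I R j i : ℤ) - Fintype.card (j ⟶ i)))

theorem isUnitForm_titsForm (hQ : Quiver.NoOrientedCycles V)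
    {I : TwoSidedIdeal (PathAlgebra k V)}
    (hI : IsAdmissible I) {R : Set (PathAlgebra k V)} (hR : IsMinimalRelations I R) :
    IntForm.IsUnitForm (titsForm I R) (titsPolar I R) := by
  have htwo : ∀ x, 2 * titsForm I R x = titsPolar I R x x := fun x => by
    have h1 : ∑ i, ∑ j, x i * ((relationCount I R j i : ℤ) - Fintype.card (j ⟶ i)) * x j =
        ∑ i, ∑ j, x i * ((relationCount I R i j : ℤ) - Fintype.card (i ⟶ j)) * x j := by
      rw [Finset.sum_comm]
      exact Finset.sum_congr rfl fun i _ => Finset.sum_congr rfl fun j _ => by ring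
    have h2 : titsPolar I R x x = 2 * ∑ i, x i ^ 2 +
        (∑ i, ∑ j, x i * ((relationCount I R i j : ℤ) - Fintype.card (i ⟶ j)) * x j +
        ∑ i, ∑ j, x i * ((relationCount I R j i : ℤ) - Fintype.card (j ⟶ i)) * x j) := by
      simp only [titsPolar, Matrix.toBilin'_apply, Matrix.of_apply, mul_add, add_mul,
        Finset.sum_add_distrib, Finset.mul_sum, add_assoc]
      congr 1
      refine Finset.sum_congr rfl fun i _ => ?_
      simp only [mul_ite, ite_mul, mul_zero, zero_mul, Finset.sum_ite_eq, Finset.mem_univ, if_true]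
      ring
    have h3 : titsForm I R x = ∑ i, x i ^ 2 +
        ∑ i, ∑ j, x i * ((relationCount I R i j : ℤ) - Fintype.card (i ⟶ j)) * x j := by
      simp only [titsForm, Finset.sum_const, Finset.card_univ, nsmul_eq_mul, mul_sub, sub_mul,
        Finset.sum_sub_distrib]
      rw [sub_add, sub_eq_add_neg, neg_sub]
      congr 2 <;>
      exact Finset.sum_congr rfl fun i _ => Finset.sum_congr rfl fun j _ => by ring
    rw [h2, h1, h3]
    ring
  refine ⟨fun x y => ?_, htwo, fun i => ?_⟩
  · simp only [titsPolar, Matrix.toBilin'_apply]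
    rw [Finset.sum_comm]
    refine Finset.sum_congr rfl fun i _ => Finset.sum_congr rfl fun j _ => ?_
    simp only [Matrix.of_apply, eq_comm (a := j)]
    ring
  · have h1 := htwo (Pi.single i 1)
    rw [titsPolar, Matrix.toBilin'_single, Matrix.of_apply, if_pos rfl,
      relationCount_self hQ hI hR, card_hom_self hQ] at h1
    norm_num at h1
    omega

end BoundQuiver

end TitsForm

theorem theorem0 {k : Type*} [Field k] [IsAlgClosed k]
    {V : Type*} [Fintype V] [DecidableEq V] [Quiver V] [∀ i j : V, Fintype (i ⟶ j)]
    (hQ : Quiver.NoOrientedCycles V)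
    (I : TwoSidedIdeal (PathAlgebra k V)) (hI : BoundQuiver.IsAdmissible I)
    {A : Type*} [Ring A] [Algebra k A] (_presentation : A ≃ₐ[k] I.ringCon.Quotient)
    (R : Set (PathAlgebra k V)) (hR : BoundQuiver.IsMinimalRelations I R)
    (hslender : IntForm.IsSlender (BoundQuiver.titsForm I R))
    (v : V → ℤ) (hv : IntForm.IsMaximalRoot (BoundQuiver.titsForm I R) v)
    (hv' : IntForm.IsOmnipresent v) :
    IntForm.IsWeaklyNonneg (BoundQuiver.titsForm I R) ∧ ∀ i : V, v i ≤ 12 := by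
  have h := BoundQuiver.isUnitForm_titsForm hQ hI hR
  have hq := hv.isWeaklyNonneg h hslender hv'
  exact ⟨hq, hv.le_twelve h hq hv'⟩
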